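/- Let $\Omega=(t_0,t_f)$ with $t_0<t_f$, let $\alpha>0$ and $M\ge 1$, and let $\nu_1<\dots<\nu_M$ be integers. Let $F:L^2(\Omega)\to\mathbb R$ be lower semicontinuous, bounded from below and twice continuously Fréchet differentiable. Assume that for every $\xi\in L^2(\Omega)$ there is $C>0$ such that $|\nabla^2F(\xi)(u,w)|\le C\|u\|_{L^1(\Omega)}\|w\|_{L^1(\Omega)}$ for all $u,w\in L^2(\Omega)$. For $v\in L^2(\Omega)$ put $\mathrm{TV}(v)=\sup\{\int_\Omega v\,\varphi'\,dx:\varphi\in C_c^1(\Omega),\ \sup|\varphi|\le 1\}\in[0,\infty]$. Call $v$ feasible if $v(x)\in\{\nu_1,\dots,\nu_M\}$ for a.a. $x\in\Omega$, and write $v\in BV(\Omega)$ if $\mathrm{TV}(v)<\infty$. **Trust-region subproblem.** For feasible $v\in BV(\Omega)$ and $\Delta>0$, let $\mathrm{TR}(v,\Delta)$ be the problem of minimizing $(\nabla F(v),w-v)_{L^2}+\alpha\mathrm{TV}(w)-\alpha\mathrm{TV}(v)$ over all feasible $w$ with $\|w-v\|_{L^1(\Omega)}\le\Delta$. Put $$\mathrm{pred}(v,w)=(\nabla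 F(v),v-w)_{L^2}+\alpha\mathrm{TV}(v)-\alpha\mathrm{TV}(w),$$ $$\mathrm{ared}(v,w)=F(v)+\alpha\mathrm{TV}(v)-F(w)-\alpha\mathrm{TV}(w).$$ **Algorithm (SLIP).** Let $\Delta^0>0$, let $\sigma\in(0,1)$, and let $v^0\in BV(\Omega)$ be feasible. For $n=1,2,\dots$ run the following inner loop over $k=0,1,2,\dots$. Let $w$ be any minimizer of $\mathrm{TR}(v^{n-1},\Delta^0 2^{-k})$. * If $\mathrm{pred}(v^{n-1},w)\le 0$, terminate the algorithm. * Otherwise, if $\mathrm{ared}(v^{n-1},w)<\sigma\,\mathrm{pred}(v^{n-1},w)$, continue the inner loop with $k+1$. * Otherwise set $v^n=w$ and go to the next $n$. The iterates are $v^0,v^1,\dots$. If there are only finitely many of them, that is, if the algorithm terminates or some inner loop never ends, the last one is called the final iterate. **L-stationarity.** A feasible $v\in BV(\Omega)$ coincides a.e. with a step function that takes values $a_1,\dots,a_N\in\{\nu_1,\dots,\nu_M\}$ on consecutive intervals with endpoints $t_0<t_1<\dots<t_N=t_f$, where $a_i\ne a_{i+1}$ for all $1\le i\le N-1$. It is called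 L-stationary if, with $g=\nabla F(v)$, the following hold for all $1\le i\le N-1$: * if $a_i<a_{i+1}$, then $\displaystyle\limsup_{h\downarrow0}\frac1h\int_{t_i-h}^{t_i}g\,ds\ \ge\ 0\ \ge\ \liminf_{h\downarrow0}\frac1h\int_{t_i}^{t_i+h}g\,ds$; * if $a_{i+1}<a_i$, then $\displaystyle\liminf_{h\downarrow0}\frac1h\int_{t_i-h}^{t_i}g\,ds\ \le\ 0\ \le\ \limsup_{h\downarrow0}\frac1h\int_{t_i}^{t_i+h}g\,ds$. The limits superior and inferior are taken in $[-\infty,\infty]$. **Claim.** In every run of the algorithm with only finitely many iterates, the final iterate is L-stationary. In every run with infinitely many iterates, every weak-$^*$ accumulation point in $BV(\Omega)$ of the sequence of iterates is L-stationary (in particular feasible). Here a weak-$^*$ accumulation point in $BV(\Omega)$ is a function $v\in BV(\Omega)$ for which some subsequence converges to $v$ in $L^1(\Omega)$ and the derivative measures of that subsequence converge weakly-$^*$ to that of $v$. -/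

import Mathlib

open MeasureTheory Set Filter Topology

noncomputable section

namespace SLIP

/-- Lebesgue measure on the interval `Ω = (t₀, tf)`. -/
abbrev intervalMeasure (t₀ tf : ℝ) : Measure ℝ := volume.restrict (Ioo t₀ tf)

/-- The Hilbert space `L²(Ω)`, `Ω = (t₀, tf)`. -/
abbrev L2 (t₀ tf : ℝ) : Type := Lp ℝ 2 (intervalMeasure t₀ tf)

/-- The `L¹(Ω)` norm. As `Ω` is bounded, it is finite on `L²(Ω)`. -/
def l1Norm {t₀ tf : ℝ} (v : L2 t₀ tf) : ℝ :=
  ∫ x, |v x| ∂(intervalMeasure t₀ tf)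

/-- `φ ∈ C¹_c(Ω)`, extended by zero to the real line. -/
def IsTestFunction (t₀ tf : ℝ) (φ : ℝ → ℝ) : Prop :=
  ContDiff ℝ 1 φ ∧ HasCompactSupport φ ∧ tsupport φ ⊆ Ioo t₀ tf

/-- The total variation, the supremum of `∫_Ω v φ'` over all `φ ∈ C¹_c(Ω)` with `|φ| ≤ 1`. The
choice `φ = 0` shows that the supremum is nonnegative, so truncation at `0` has no effect. -/
def TV {t₀ tf : ℝ} (v : L2 t₀ tf) : ENNReal :=
  ⨆ (φ : ℝ → ℝ) (_ : IsTestFunction t₀ tf φ) (_ : ∀ x, |φ x| ≤ 1),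
    ENNReal.ofReal (∫ x, v x * deriv φ x ∂(intervalMeasure t₀ tf))

/-- Membership in `BV(Ω)`; elements of `L²(Ω)` lie in `L¹(Ω)` since `Ω` is bounded. -/
def IsBV {t₀ tf : ℝ} (v : L2 t₀ tf) : Prop := TV v < ⊤

/-- On `Ω`, the finite signed measure `ρ` is the distributional derivative of `v`. -/
def IsDerivMeasure {t₀ tf : ℝ} (v : L2 t₀ tf) (ρ : SignedMeasure ℝ) : Prop :=
  ∀ φ : ℝ → ℝ, IsTestFunction t₀ tf φ →
    ∫ x, v x * deriv φ x ∂(intervalMeasure t₀ tf) = -∫ᵛ x, φ x ∂•ρ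

/-- Weak-* convergence in `BV(Ω)`: convergence in `L¹(Ω)`, and weak-* convergence of the
derivative measures, tested with `C₀(Ω)`, the continuous functions on the real line that
vanish outside `Ω`. -/
def WeakStarTendsto {t₀ tf : ℝ} (u : ℕ → L2 t₀ tf) (w : L2 t₀ tf) : Prop :=
  (∀ k, IsBV (u k)) ∧ IsBV w ∧
  Tendsto (fun k => l1Norm (u k - w)) atTop (𝓝 0) ∧
  ∃ (D : ℕ → SignedMeasure ℝ) (D' : SignedMeasure ℝ),
    (∀ k, IsDerivMeasure (u k) (D k)) ∧ IsDerivMeasure w D' ∧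
    ∀ φ : ℝ → ℝ, Continuous φ → (∀ x, x ∉ Ioo t₀ tf → φ x = 0) →
      Tendsto (fun k => ∫ᵛ x, φ x ∂•(D k)) atTop (𝓝 (∫ᵛ x, φ x ∂•D'))

/-- `w` is a weak-* accumulation point in `BV(Ω)` of the sequence `v`. -/
def IsWeakStarLimitPoint {t₀ tf : ℝ} (v : ℕ → L2 t₀ tf) (w : L2 t₀ tf) : Prop :=
  ∃ s : ℕ → ℕ, StrictMono s ∧ WeakStarTendsto (fun k => v (s k)) w

/-- Feasibility: `v(x) ∈ {ν₁, …, ν_M}` for almost all `x ∈ Ω`. -/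
def Feasible {t₀ tf : ℝ} {M : ℕ} (ν : Fin M → ℤ) (v : L2 t₀ tf) : Prop :=
  ∀ᵐ x ∂(intervalMeasure t₀ tf), ∃ i, v x = (ν i : ℝ)

/-! ### The algorithm -/

/-- The objective of the trust-region subproblem `TR(v, g, Δ)` at `w`, for `v, w ∈ BV(Ω)`. -/
def trObjective {t₀ tf : ℝ} (α : ℝ) (v g w : L2 t₀ tf) : ℝ :=
  inner ℝ g (w - v) + α * (TV w).toReal - α * (TV v).toReal

/-- `w` is a minimizer of `TR(v, g, Δ)`, where `v` is feasible and in `BV(Ω)`. Points outside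
`BV(Ω)` have the objective value `+∞` and `v` itself has the value `0`, so that only points of
`BV(Ω)` compete. -/
def IsTRMinimizer {t₀ tf : ℝ} {M : ℕ} (α : ℝ) (ν : Fin M → ℤ) (v g : L2 t₀ tf) (Δ : ℝ)
    (w : L2 t₀ tf) : Prop :=
  (Feasible ν w ∧ IsBV w ∧ l1Norm (w - v) ≤ Δ) ∧
  ∀ w' : L2 t₀ tf, Feasible ν w' → IsBV w' → l1Norm (w' - v) ≤ Δ →
    trObjective α v g w ≤ trObjective α v g w'

/-- Predicted reduction of the step from `v` to `w`. -/
def pred {t₀ tf : ℝ} (α : ℝ) (F : L2 t₀ tf → ℝ) (v w : L2 t₀ tf) : ℝ :=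
  inner ℝ (gradient F v) (v - w) + α * (TV v).toReal - α * (TV w).toReal

/-- Actual reduction of the step from `v` to `w`. -/
def ared {t₀ tf : ℝ} (α : ℝ) (F : L2 t₀ tf → ℝ) (v w : L2 t₀ tf) : ℝ :=
  F v + α * (TV v).toReal - F w - α * (TV w).toReal

/-- The inner iteration with current iterate `v`, radius `Δ` and computed minimizer `w`
triggers termination of the algorithm. -/
def TerminatingStep {t₀ tf : ℝ} {M : ℕ} (α : ℝ) (ν : Fin M → ℤ) (F : L2 t₀ tf → ℝ)
    (v : L2 t₀ tf) (Δ : ℝ) (w : L2 t₀ tf) : Prop :=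
  IsTRMinimizer α ν v (gradient F v) Δ w ∧ pred α F v w ≤ 0

/-- The minimizer `w` is rejected (and the radius is halved). -/
def RejectedStep {t₀ tf : ℝ} {M : ℕ} (α σ : ℝ) (ν : Fin M → ℤ) (F : L2 t₀ tf → ℝ)
    (v : L2 t₀ tf) (Δ : ℝ) (w : L2 t₀ tf) : Prop :=
  IsTRMinimizer α ν v (gradient F v) Δ w ∧ 0 < pred α F v w ∧
    ared α F v w < σ * pred α F v w

/-- The minimizer `w` is accepted (sufficient decrease). -/
def AcceptedStep {t₀ tf : ℝ} {M : ℕ} (α σ : ℝ) (ν : Fin M → ℤ) (F : L2 t₀ tf → ℝ)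
    (v : L2 t₀ tf) (Δ : ℝ) (w : L2 t₀ tf) : Prop :=
  IsTRMinimizer α ν v (gradient F v) Δ w ∧ 0 < pred α F v w ∧
    σ * pred α F v w ≤ ared α F v w

/-- The inner loop started at the iterate `v` with radii `Δ₀ / 2 ^ k`, `k = 0, 1, …`, rejects
finitely many candidates and then accepts `v'` as the next iterate. -/
def InnerLoopAccepts {t₀ tf : ℝ} {M : ℕ} (α σ Δ₀ : ℝ) (ν : Fin M → ℤ) (F : L2 t₀ tf → ℝ)
    (v v' : L2 t₀ tf) : Prop :=
  ∃ (K : ℕ) (w : ℕ → L2 t₀ tf),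
    (∀ k < K, RejectedStep α σ ν F v (Δ₀ / 2 ^ k) (w k)) ∧
    AcceptedStep α σ ν F v (Δ₀ / 2 ^ K) v'

/-- The inner loop started at the iterate `v` rejects finitely many candidates, and then the
algorithm terminates because the predicted reduction is not positive. -/
def InnerLoopTerminates {t₀ tf : ℝ} {M : ℕ} (α σ Δ₀ : ℝ) (ν : Fin M → ℤ)
    (F : L2 t₀ tf → ℝ) (v : L2 t₀ tf) : Prop :=
  ∃ (K : ℕ) (w : ℕ → L2 t₀ tf),
    (∀ k < K, RejectedStep α σ ν F v (Δ₀ / 2 ^ k) (w k)) ∧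
    TerminatingStep α ν F v (Δ₀ / 2 ^ K) (w K)

/-- The inner loop started at the iterate `v` rejects candidates forever. -/
def InnerLoopRunsForever {t₀ tf : ℝ} {M : ℕ} (α σ Δ₀ : ℝ) (ν : Fin M → ℤ)
    (F : L2 t₀ tf → ℝ) (v : L2 t₀ tf) : Prop :=
  ∃ w : ℕ → L2 t₀ tf, ∀ k, RejectedStep α σ ν F v (Δ₀ / 2 ^ k) (w k)

/-- `v 0, …, v N` are all the iterates of a run of the algorithm that accepts only finitely
many steps: at the final iterate `v N` either the algorithm terminates, or the inner loop does
not end. -/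
def IsRunWithFinalIterate {t₀ tf : ℝ} {M : ℕ} (α σ Δ₀ : ℝ) (ν : Fin M → ℤ)
    (F : L2 t₀ tf → ℝ) (v₀ : L2 t₀ tf) (N : ℕ) (v : ℕ → L2 t₀ tf) : Prop :=
  v 0 = v₀ ∧ (∀ n < N, InnerLoopAccepts α σ Δ₀ ν F (v n) (v (n + 1))) ∧
  (InnerLoopTerminates α σ Δ₀ ν F (v N) ∨ InnerLoopRunsForever α σ Δ₀ ν F (v N))

/-- `v 0, v 1, …` are the iterates of a run that produces infinitely many iterates. -/
def IsInfiniteRun {t₀ tf : ℝ} {M : ℕ} (α σ Δ₀ : ℝ) (ν : Fin M → ℤ)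
    (F : L2 t₀ tf → ℝ) (v₀ : L2 t₀ tf) (v : ℕ → L2 t₀ tf) : Prop :=
  v 0 = v₀ ∧ ∀ n, InnerLoopAccepts α σ Δ₀ ν F (v n) (v (n + 1))

/-! ### L-stationarity -/

/-- The step function
`χ_(t_0, t_1) a_1 + ∑_{i = 1}^{N - 1} χ_[t_i, t_{i+1}) a_{i+1}`. -/
def stepFunction (N : ℕ) (t a : ℕ → ℝ) (x : ℝ) : ℝ :=
  (Ioo (t 0) (t 1)).indicator (fun _ => a 1) x +
    ∑ i ∈ Finset.Ico 1 N, (Ico (t i) (t (i + 1))).indicator (fun _ => a (i + 1)) x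

/-- `v = v^{t,a}` (almost everywhere on `Ω`) with `t₀ = t_0 < ⋯ < t_N = tf`, values
`a_1, …, a_N ∈ {ν₁, …, ν_M}` and `a_i ≠ a_{i+1}` for `1 ≤ i ≤ N - 1`. Only `t_0, …, t_N` and
`a_1, …, a_N` matter. -/
structure IsStepRepresentation {t₀ tf : ℝ} {M : ℕ} (ν : Fin M → ℤ) (v : L2 t₀ tf)
    (N : ℕ) (t a : ℕ → ℝ) : Prop where
  one_le : 1 ≤ N
  left_end : t 0 = t₀
  right_end : t N = tf
  nodes_lt : ∀ i < N, t i < t (i + 1)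
  values : ∀ i, 1 ≤ i → i ≤ N → ∃ j, a i = (ν j : ℝ)
  jumps : ∀ i, 1 ≤ i → i < N → a i ≠ a (i + 1)
  eq_step : ∀ᵐ x ∂(intervalMeasure t₀ tf), v x = stepFunction N t a x

/-- Upper right Dini derivative of `τ ↦ ∫_{s}^{τ} g` at `s`; it may be infinite. -/
def upperRightDini {t₀ tf : ℝ} (g : L2 t₀ tf) (s : ℝ) : EReal :=
  limsup (fun h : ℝ => ((1 / h * ∫ x in s..(s + h), g x : ℝ) : EReal)) (𝓝[>] 0)

/-- Upper left Dini derivative. -/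
def upperLeftDini {t₀ tf : ℝ} (g : L2 t₀ tf) (s : ℝ) : EReal :=
  limsup (fun h : ℝ => ((1 / h * ∫ x in (s - h)..s, g x : ℝ) : EReal)) (𝓝[>] 0)

/-- Lower right Dini derivative. -/
def lowerRightDini {t₀ tf : ℝ} (g : L2 t₀ tf) (s : ℝ) : EReal :=
  liminf (fun h : ℝ => ((1 / h * ∫ x in s..(s + h), g x : ℝ) : EReal)) (𝓝[>] 0)

/-- Lower left Dini derivative. -/
def lowerLeftDini {t₀ tf : ℝ} (g : L2 t₀ tf) (s : ℝ) : EReal :=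
  liminf (fun h : ℝ => ((1 / h * ∫ x in (s - h)..s, g x : ℝ) : EReal)) (𝓝[>] 0)

/-- L-stationarity of `v`: `v` is feasible and in `BV(Ω)`, and the Dini conditions on `∇F(v)`
hold at every switching location of its (unique) representation as a step function. -/
def LStationary {t₀ tf : ℝ} {M : ℕ} (ν : Fin M → ℤ) (F : L2 t₀ tf → ℝ)
    (v : L2 t₀ tf) : Prop :=
  Feasible ν v ∧ IsBV v ∧
  ∃ (N : ℕ) (t a : ℕ → ℝ), IsStepRepresentation ν v N t a ∧
    ∀ i, 1 ≤ i → i < N →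
      (a i < a (i + 1) →
        0 ≤ upperLeftDini (gradient F v) (t i) ∧ lowerRightDini (gradient F v) (t i) ≤ 0) ∧
      (a (i + 1) < a i →
        lowerLeftDini (gradient F v) (t i) ≤ 0 ∧ 0 ≤ upperRightDini (gradient F v) (t i))

end SLIP

end

noncomputable section

namespace SLIP

variable {t₀ tf : ℝ} {M : ℕ} {ν : Fin M → ℤ}

/-! ### The `L¹` norm and feasible functions -/

/-! The argument is by contradiction at a point `v` that is not L-stationary. A feasible BV function
is a step function (`exists_isStepRepresentation`), so some Dini condition fails at a switching
location. Moving that location by `h` to the appropriate side keeps feasibility, does not increase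
the total variation, costs an `L¹` distance proportional to `h`, and lowers the linear model by at
least a multiple of `h` (`exists_shift`, `exists_descent_of_not_LStationary`). Hence the predicted
reduction is at least linear in the trust-region radius.

The model error is of smaller order: for feasible `u`, `w` near `v` in `L¹` it is at most `ε‖w -
u‖₁` with `ε` arbitrary (`exists_remainder_bound`). The Hessian at `v` contributes `C‖w - u‖₁²`. The
change of the Hessian is small only in operator norm, hence against `‖w - u‖₂²`, but differences of
feasible functions are uniformly bounded, so `‖w - u‖₂² ≤ B‖w - u‖₁`.

Both estimates persist for iterates close to `v` in `L¹`: feasibility upgrades the convergence to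
`L²`, where the gradient is continuous, and the total variation is lower semicontinuous. So one
fixed radius works for all nearby iterates (`exists_radius_not_rejected`): its candidates are never
rejected, and it and all larger radii predict a reduction of at least some `η > 0`. At a final
iterate this excludes termination and endless rejection. In an infinite run accumulating at `v`, the
objective would drop by at least `σ η` infinitely often although it is monotone and bounded below.
-/

lemma L2.integrable (v : L2 t₀ tf) : Integrable v (intervalMeasure t₀ tf) :=
  (Lp.memLp v).integrable one_le_two

lemma l1Norm_nonneg (v : L2 t₀ tf) : 0 ≤ l1Norm v :=
  integral_nonneg fun _ => abs_nonneg _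

lemma l1Norm_sub_comm (v w : L2 t₀ tf) : l1Norm (v - w) = l1Norm (w - v) := by
  refine integral_congr_ae ?_
  filter_upwards [Lp.coeFn_sub v w, Lp.coeFn_sub w v] with x h1 h2
  simp only [h1, h2, Pi.sub_apply, abs_sub_comm]

lemma l1Norm_sub_le (u v w : L2 t₀ tf) :
    l1Norm (u - w) ≤ l1Norm (u - v) + l1Norm (v - w) := by
  unfold l1Norm
  rw [← integral_add (L2.integrable _).abs (L2.integrable _).abs]
  refine integral_mono_ae (L2.integrable _).abs
    ((L2.integrable _).abs.add (L2.integrable _).abs) ?_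
  filter_upwards [Lp.coeFn_sub u w, Lp.coeFn_sub u v, Lp.coeFn_sub v w] with x h1 h2 h3
  simp only [h1, h2, h3, Pi.sub_apply]
  exact abs_sub_le _ _ _

/-- Twice a common bound of the absolute values of the admissible values. -/
def valueBound (ν : Fin M → ℤ) : ℝ := 2 * ∑ i, |(ν i : ℝ)|

lemma valueBound_nonneg (ν : Fin M → ℤ) : 0 ≤ valueBound ν := by
  unfold valueBound; positivity

lemma abs_sub_le_valueBound (i j : Fin M) : |(ν i : ℝ) - ν j| ≤ valueBound ν := by
  have h (k : Fin M) : |(ν k : ℝ)| ≤ ∑ i, |(ν i : ℝ)| :=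
    Finset.single_le_sum (f := fun i => |(ν i : ℝ)|) (fun _ _ => abs_nonneg _) (Finset.mem_univ k)
  unfold valueBound
  linarith [abs_sub (ν i : ℝ) (ν j), h i, h j]

/-- Pointwise `|w - v| ≤ valueBound ν`, so one factor of the square can be replaced by this bound.
This converts `L¹` smallness into `L²` smallness. -/
lemma norm_sub_sq_le {v w : L2 t₀ tf} (hv : Feasible ν v) (hw : Feasible ν w) :
    ‖w - v‖ ^ 2 ≤ valueBound ν * l1Norm (w - v) := by
  have hint : Integrable (fun x => (w - v : L2 t₀ tf) x * (w - v : L2 t₀ tf) x)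
      (intervalMeasure t₀ tf) := by
    have := MeasureTheory.L2.integrable_inner (𝕜 := ℝ) (w - v) (w - v)
    simpa [pow_two] using this
  rw [← real_inner_self_eq_norm_sq, MeasureTheory.L2.inner_def, l1Norm, ← integral_const_mul]
  simp only [RCLike.inner_apply, conj_trivial]
  refine integral_mono_ae hint ((L2.integrable _).abs.const_mul _) ?_
  filter_upwards [hv, hw, Lp.coeFn_sub w v] with x ⟨i, hi⟩ ⟨j, hj⟩ h
  simp only [h, Pi.sub_apply, hi, hj]
  rw [← abs_mul_abs_self]
  exact mul_le_mul_of_nonneg_right (abs_sub_le_valueBound j i) (abs_nonneg _)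

lemma tendsto_of_l1Norm_tendsto {v : ℕ → L2 t₀ tf} {w : L2 t₀ tf} (hv : ∀ n, Feasible ν (v n))
    (hw : Feasible ν w) (h : Tendsto (fun n => l1Norm (v n - w)) atTop (𝓝 0)) :
    Tendsto v atTop (𝓝 w) := by
  rw [tendsto_iff_norm_sub_tendsto_zero]
  have h2 : Tendsto (fun n => ‖v n - w‖ ^ 2) atTop (𝓝 0) := by
    refine squeeze_zero (fun _ => by positivity) (fun n => norm_sub_sq_le hw (hv n)) ?_
    simpa using h.const_mul (valueBound ν)
  simpa [Real.sqrt_sq (norm_nonneg _)] using h2.sqrt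

/-- A subsequence converges almost everywhere, and the finite set of admissible values is closed. -/
lemma feasible_of_l1Norm_tendsto {v : ℕ → L2 t₀ tf} {w : L2 t₀ tf} (hv : ∀ n, Feasible ν (v n))
    (h : Tendsto (fun n => l1Norm (v n - w)) atTop (𝓝 0)) : Feasible ν w := by
  have hm : TendstoInMeasure (intervalMeasure t₀ tf) (fun n => (v n : ℝ → ℝ)) atTop w := by
    refine tendstoInMeasure_of_tendsto_eLpNorm (p := 1) one_ne_zero
      (fun n => Lp.aestronglyMeasurable _) (Lp.aestronglyMeasurable _) ?_
    have h' := ENNReal.tendsto_ofReal h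
    rw [ENNReal.ofReal_zero] at h'
    refine h'.congr fun n => ?_
    rw [l1Norm, ofReal_integral_eq_lintegral_ofReal (L2.integrable _).abs
      (ae_of_all _ fun _ => abs_nonneg _), eLpNorm_one_eq_lintegral_enorm]
    refine lintegral_congr_ae ?_
    filter_upwards [Lp.coeFn_sub (v n) w] with x hx
    rw [hx, ← Real.norm_eq_abs, ofReal_norm]
  obtain ⟨s, -, hs⟩ := hm.exists_seq_tendsto_ae
  filter_upwards [hs, ae_all_iff.2 hv] with x hx hvx
  have hc : IsClosed (range fun i => (ν i : ℝ)) := (finite_range _).isClosed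
  obtain ⟨i, hi⟩ := hc.mem_of_tendsto hx
    (Eventually.of_forall fun n => by obtain ⟨i, hi⟩ := hvx (s n); exact ⟨i, hi.symm⟩)
  exact ⟨i, hi.symm⟩

/-! ### Lower semicontinuity of the total variation -/

lemma IsTestFunction.exists_bound_deriv {φ : ℝ → ℝ} (hφ : IsTestFunction t₀ tf φ) :
    ∃ C, ∀ x, ‖deriv φ x‖ ≤ C :=
  hφ.2.1.deriv.exists_bound_of_continuous (hφ.1.continuous_deriv le_rfl)

lemma IsTestFunction.integrable_mul_deriv {φ : ℝ → ℝ} (hφ : IsTestFunction t₀ tf φ)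
    (v : L2 t₀ tf) : Integrable (fun x => v x * deriv φ x) (intervalMeasure t₀ tf) := by
  obtain ⟨C, hC⟩ := hφ.exists_bound_deriv
  exact (L2.integrable v).mul_bdd
    (hφ.1.continuous_deriv le_rfl).aestronglyMeasurable (ae_of_all _ hC)

lemma tendsto_integral_mul_deriv {v : ℕ → L2 t₀ tf} {w : L2 t₀ tf}
    (h : Tendsto (fun n => l1Norm (v n - w)) atTop (𝓝 0)) {φ : ℝ → ℝ}
    (hφ : IsTestFunction t₀ tf φ) :
    Tendsto (fun n => ∫ x, v n x * deriv φ x ∂(intervalMeasure t₀ tf)) atTop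
      (𝓝 (∫ x, w x * deriv φ x ∂(intervalMeasure t₀ tf))) := by
  obtain ⟨C, hC⟩ := hφ.exists_bound_deriv
  rw [tendsto_iff_dist_tendsto_zero]
  refine squeeze_zero (fun _ => dist_nonneg) (g := fun n => C * l1Norm (v n - w)) (fun n => ?_)
    (by simpa using h.const_mul C)
  rw [Real.dist_eq, ← integral_sub (hφ.integrable_mul_deriv _) (hφ.integrable_mul_deriv _),
    l1Norm, ← integral_const_mul]
  refine (abs_integral_le_integral_abs).trans (integral_mono_ae
    ((hφ.integrable_mul_deriv _).sub (hφ.integrable_mul_deriv _)).abs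
    ((L2.integrable _).abs.const_mul _) ?_)
  filter_upwards [Lp.coeFn_sub (v n) w] with x hx
  simp only [hx, Pi.sub_apply, ← sub_mul, abs_mul]
  rw [mul_comm]
  exact mul_le_mul_of_nonneg_right (hC x) (abs_nonneg _)

lemma ofReal_integral_le_TV (v : L2 t₀ tf) {φ : ℝ → ℝ} (hφ : IsTestFunction t₀ tf φ)
    (h1 : ∀ x, |φ x| ≤ 1) :
    ENNReal.ofReal (∫ x, v x * deriv φ x ∂(intervalMeasure t₀ tf)) ≤ TV v :=
  le_iSup_of_le φ (le_iSup_of_le hφ (le_iSup_of_le h1 le_rfl))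

lemma integral_le_TV_toReal {v : L2 t₀ tf} (hv : IsBV v) {φ : ℝ → ℝ}
    (hφ : IsTestFunction t₀ tf φ) (h1 : ∀ x, |φ x| ≤ 1) :
    ∫ x, v x * deriv φ x ∂(intervalMeasure t₀ tf) ≤ (TV v).toReal :=
  (ENNReal.ofReal_le_iff_le_toReal hv.ne).1 (ofReal_integral_le_TV v hφ h1)

/-- Lower semicontinuity of a supremum of `L¹`-continuous functionals: a single test function that
beats `b` for `w` eventually beats it for `v n`. -/
lemma eventually_lt_TV_toReal {v : ℕ → L2 t₀ tf} {w : L2 t₀ tf} (hv : ∀ n, IsBV (v n))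
    (hw : IsBV w) (h : Tendsto (fun n => l1Norm (v n - w)) atTop (𝓝 0)) {b : ℝ}
    (hb : b < (TV w).toReal) : ∀ᶠ n in atTop, b < (TV (v n)).toReal := by
  rcases lt_or_ge b 0 with hb0 | hb0
  · exact Eventually.of_forall fun n => hb0.trans_le ENNReal.toReal_nonneg
  have hb' : ENNReal.ofReal b < TV w := (ENNReal.ofReal_lt_iff_lt_toReal hb0 hw.ne).2 hb
  simp only [TV, lt_iSup_iff] at hb'
  obtain ⟨φ, hφ, h1, hlt⟩ := hb'
  have hlt' := (ENNReal.ofReal_lt_ofReal_iff_of_nonneg hb0).1 hlt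
  filter_upwards [(tendsto_integral_mul_deriv h hφ).eventually_const_lt hlt'] with n hn
  exact hn.trans_le (integral_le_TV_toReal (hv n) hφ h1)

/-! ### The remainder of the linear model -/

lemma inner_gradient {F : L2 t₀ tf → ℝ} (v d : L2 t₀ tf) :
    inner ℝ (gradient F v) d = fderiv ℝ F v d := by
  rw [← toDual_gradient, InnerProductSpace.toDual_apply_apply]

/-- The mean value inequality is applied twice along the segment, first to the directional
derivative and then to `F` minus its linear part; the factor `1/2` of Taylor's formula is not
needed. -/
lemma abs_remainder_le {F : L2 t₀ tf → ℝ} (hF : ContDiff ℝ 2 F) (v d : L2 t₀ tf) {K : ℝ}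
    (hK : ∀ s ∈ Icc (0 : ℝ) 1, |fderiv ℝ (fderiv ℝ F) (v + s • d) d d| ≤ K) :
    |F (v + d) - F v - fderiv ℝ F v d| ≤ K := by
  have hline (s : ℝ) : HasDerivAt (fun s : ℝ => v + s • d) d s := by
    simpa using ((hasDerivAt_id s).smul_const d).const_add v
  have hF1 : Differentiable ℝ F := hF.differentiable two_ne_zero
  have hF2 : Differentiable ℝ (fderiv ℝ F) :=
    (hF.fderiv_right (m := 1) (by norm_num)).differentiable one_ne_zero
  have hK0 : 0 ≤ K := (abs_nonneg _).trans (hK 0 (by simp))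
  have h2 (s : ℝ) : HasDerivAt (fun s : ℝ => fderiv ℝ F (v + s • d) d)
      (fderiv ℝ (fderiv ℝ F) (v + s • d) d d) s := by
    have := (hF2 (v + s • d)).hasFDerivAt.comp_hasDerivAt s (hline s)
    simpa using this.clm_apply (hasDerivAt_const s d)
  have h1 (s : ℝ) : HasDerivAt (fun s : ℝ => F (v + s • d) - s * fderiv ℝ F v d)
      (fderiv ℝ F (v + s • d) d - fderiv ℝ F v d) s := by
    have := (hF1 (v + s • d)).hasFDerivAt.comp_hasDerivAt s (hline s)
    have h3 := this.sub ((hasDerivAt_id s).mul_const (fderiv ℝ F v d))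
    rw [one_mul] at h3
    exact h3
  have b1 : ∀ s ∈ Icc (0 : ℝ) 1, ‖fderiv ℝ F (v + s • d) d - fderiv ℝ F v d‖ ≤ K := by
    intro s hs
    have := Convex.norm_image_sub_le_of_norm_hasDerivWithin_le
      (fun x _ => (h2 x).hasDerivWithinAt) (fun x hx => hK x hx) (convex_Icc (0 : ℝ) 1)
      (left_mem_Icc.2 zero_le_one) hs
    simp only [zero_smul, add_zero, sub_zero] at this
    refine this.trans ?_
    rw [Real.norm_of_nonneg hs.1]
    exact mul_le_of_le_one_right hK0 hs.2
  have := Convex.norm_image_sub_le_of_norm_hasDerivWithin_le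
      (fun x _ => (h1 x).hasDerivWithinAt) b1 (convex_Icc (0 : ℝ) 1)
      (left_mem_Icc.2 zero_le_one) (right_mem_Icc.2 zero_le_one)
  simp only [zero_smul, add_zero, sub_zero, one_smul, zero_mul, one_mul, norm_one, mul_one,
    Real.norm_eq_abs] at this
  rwa [sub_right_comm] at this

lemma exists_remainder_bound {F : L2 t₀ tf → ℝ} (hF : ContDiff ℝ 2 F) (v : L2 t₀ tf)
    (hv : Feasible ν v)
    (hH : ∃ C : ℝ, 0 < C ∧ ∀ u w : L2 t₀ tf,
      |fderiv ℝ (fderiv ℝ F) v u w| ≤ C * l1Norm u * l1Norm w) {ε : ℝ} (hε : 0 < ε) :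
    ∃ ρ > 0, ∀ u w : L2 t₀ tf, Feasible ν u → Feasible ν w → l1Norm (u - v) ≤ ρ →
      l1Norm (w - u) ≤ ρ → |F w - F u - fderiv ℝ F u (w - u)| ≤ ε * l1Norm (w - u) := by
  obtain ⟨C, hC, hH⟩ := hH
  set B := valueBound ν
  have hB : 0 ≤ B := valueBound_nonneg ν
  have hcont : Continuous (fderiv ℝ (fderiv ℝ F)) :=
    (hF.fderiv_right (m := 1) (by norm_num)).continuous_fderiv one_ne_zero
  have hε' : 0 < ε / (2 * (B + 1)) := by positivity
  have hlim : Tendsto (fun x => ‖fderiv ℝ (fderiv ℝ F) x - fderiv ℝ (fderiv ℝ F) v‖) (𝓝 v)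
      (𝓝 0) := by
    have hc : Continuous fun x => ‖fderiv ℝ (fderiv ℝ F) x - fderiv ℝ (fderiv ℝ F) v‖ :=
      (continuous_norm (E := L2 t₀ tf →L[ℝ] L2 t₀ tf →L[ℝ] ℝ)).comp (hcont.sub continuous_const)
    have h0 : ‖fderiv ℝ (fderiv ℝ F) v - fderiv ℝ (fderiv ℝ F) v‖ = 0 := by
      rw [sub_self]
      exact norm_zero (E := L2 t₀ tf →L[ℝ] L2 t₀ tf →L[ℝ] ℝ)
    have h1 := hc.tendsto v
    rwa [h0] at h1
  obtain ⟨δ, hδ, hcv⟩ := Metric.eventually_nhds_iff.1 (hlim.eventually_lt_const hε')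
  -- The first bound gives `C‖w - u‖₁ ≤ ε / 2`. The second makes `u - v` and `w - u` shorter than `δ
  -- / 2` in `L²`, so the whole segment stays in the `δ`-ball around `v`. Using `B + 1` avoids
  -- division by zero.
  refine ⟨min (ε / (2 * C)) (δ ^ 2 / (16 * (B + 1))), by positivity, fun u w hu hw huv hwu => ?_⟩
  have hsmall {a b : L2 t₀ tf} (ha : Feasible ν a) (hb : Feasible ν b)
      (h : l1Norm (b - a) ≤ min (ε / (2 * C)) (δ ^ 2 / (16 * (B + 1)))) : ‖b - a‖ < δ / 2 := by
    refine lt_of_pow_lt_pow_left₀ 2 (by positivity) ((norm_sub_sq_le ha hb).trans_lt ?_)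
    have h1 : B * l1Norm (b - a) ≤ B * (δ ^ 2 / (16 * (B + 1))) :=
      mul_le_mul_of_nonneg_left (h.trans (min_le_right _ _)) hB
    refine h1.trans_lt ?_
    rw [mul_div_assoc', div_lt_iff₀ (by positivity)]
    nlinarith [sq_nonneg δ, pow_pos hδ 2, mul_nonneg hB (sq_nonneg δ)]
  have n1 := hsmall hv hu huv
  have n2 := hsmall hu hw hwu
  have hl := l1Norm_nonneg (w - u)
  have key := abs_remainder_le hF u (w - u) (K := ε * l1Norm (w - u)) ?_
  · simpa using key
  intro s hs
  have hd : dist (u + s • (w - u)) v < δ := by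
    rw [dist_eq_norm]
    calc ‖u + s • (w - u) - v‖ = ‖(u - v) + s • (w - u)‖ := by congr 1; abel
      _ ≤ ‖u - v‖ + ‖s • (w - u)‖ := norm_add_le _ _
      _ ≤ ‖u - v‖ + ‖w - u‖ := by
        rw [norm_smul, Real.norm_of_nonneg hs.1]
        gcongr
        exact mul_le_of_le_one_left (norm_nonneg _) hs.2
      _ < δ := by linarith
  have hop : ‖fderiv ℝ (fderiv ℝ F) (u + s • (w - u)) - fderiv ℝ (fderiv ℝ F) v‖
      ≤ ε / (2 * (B + 1)) := (hcv hd).le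
  set T := fderiv ℝ (fderiv ℝ F) (u + s • (w - u))
  set S := fderiv ℝ (fderiv ℝ F) v
  have e1 : |(T - S) (w - u) (w - u)| ≤ ε / 2 * l1Norm (w - u) := by
    have h1 : ‖(T - S) (w - u) (w - u)‖ ≤ ‖T - S‖ * ‖w - u‖ * ‖w - u‖ :=
      (T - S).le_opNorm₂ _ _
    calc |(T - S) (w - u) (w - u)| ≤ ‖T - S‖ * ‖w - u‖ ^ 2 := by
          rw [pow_two, ← mul_assoc]; exact h1
      _ ≤ ε / (2 * (B + 1)) * (B * l1Norm (w - u)) :=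
          mul_le_mul hop (norm_sub_sq_le hu hw) (by positivity) hε'.le
      _ ≤ ε / 2 * l1Norm (w - u) := by
          rw [← mul_assoc]
          refine mul_le_mul_of_nonneg_right ?_ hl
          rw [div_mul_eq_mul_div, div_le_div_iff₀ (by positivity) (by positivity)]
          nlinarith
  have e2 : |S (w - u) (w - u)| ≤ ε / 2 * l1Norm (w - u) := by
    refine (hH _ _).trans (mul_le_mul_of_nonneg_right ?_ hl)
    have := hwu.trans (min_le_left _ _)
    calc C * l1Norm (w - u) ≤ C * (ε / (2 * C)) := by gcongr
      _ = ε / 2 := by field_simp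
  have e3 : T (w - u) (w - u) = (T - S) (w - u) (w - u) + S (w - u) (w - u) := by simp
  rw [e3]
  linarith [abs_add_le ((T - S) (w - u) (w - u)) (S (w - u) (w - u))]

/-! ### Step functions as sums of jumps -/

/-- The unit jump at `s`. -/
def unitJump (s x : ℝ) : ℝ := (Ici s).indicator (fun _ => (1 : ℝ)) x

lemma unitJump_of_le {s x : ℝ} (h : s ≤ x) : unitJump s x = 1 := indicator_of_mem (mem_Ici.2 h) _

lemma unitJump_of_lt {s x : ℝ} (h : x < s) : unitJump s x = 0 :=
  indicator_of_notMem (fun h' => absurd (mem_Ici.1 h') (not_le.2 h)) _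

lemma measurable_unitJump (s : ℝ) : Measurable (unitJump s) :=
  measurable_const.indicator measurableSet_Ici

lemma abs_unitJump_le (s x : ℝ) : |unitJump s x| ≤ 1 := by
  rcases le_or_gt s x with h | h
  · simp [unitJump_of_le h]
  · simp [unitJump_of_lt h]

lemma indicator_Ico_eq_unitJump_sub {s r : ℝ} (h : s ≤ r) (c x : ℝ) :
    (Ico s r).indicator (fun _ => c) x = c * (unitJump s x - unitJump r x) := by
  rcases lt_or_ge x s with h1 | h1
  · rw [unitJump_of_lt h1, unitJump_of_lt (h1.trans_le h), indicator_of_notMem] <;> simp [h1]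
  rcases lt_or_ge x r with h2 | h2
  · rw [unitJump_of_le h1, unitJump_of_lt h2, indicator_of_mem (mem_Ico.2 ⟨h1, h2⟩)]; simp
  · rw [unitJump_of_le h1, unitJump_of_le h2, indicator_of_notMem] <;> simp [h2]

/-- The function that starts with the value `a 1` and jumps from `a i` to `a (i + 1)` at `t i`
for `1 ≤ i < N`. -/
def jumpSum (N : ℕ) (t a : ℕ → ℝ) (x : ℝ) : ℝ :=
  a 1 + ∑ i ∈ Finset.Ico 1 N, (a (i + 1) - a i) * unitJump (t i) x

/-- The step function vanishes from `t N` on, whereas the sum of jumps keeps the value `a N`;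
recording this correction lets the induction on `N` close. -/
lemma stepFunction_eq_jumpSum_sub {N : ℕ} (hN : 1 ≤ N) {t a : ℕ → ℝ} (x : ℝ) :
    (∀ i < N, t i ≤ t (i + 1)) → t 0 < x →
      stepFunction N t a x = jumpSum N t a x - a N * unitJump (t N) x := by
  induction N, hN using Nat.le_induction with
  | base =>
    intro _ hx
    simp only [stepFunction, jumpSum, Finset.Ico_self, Finset.sum_empty, add_zero]
    rcases lt_or_ge x (t 1) with h | h
    · rw [unitJump_of_lt h, indicator_of_mem (mem_Ioo.2 ⟨hx, h⟩)]; simp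
    · rw [unitJump_of_le h, indicator_of_notMem] <;> simp [h]
  | succ N hN ih =>
    intro ht hx
    have := ih (fun i hi => ht i (by omega)) hx
    simp only [stepFunction, jumpSum] at this ⊢
    rw [Finset.sum_Ico_succ_top hN, Finset.sum_Ico_succ_top hN, ← add_assoc, this,
      indicator_Ico_eq_unitJump_sub (ht N (by omega))]
    ring

lemma stepFunction_eq_jumpSum {N : ℕ} (hN : 1 ≤ N) {t a : ℕ → ℝ}
    (ht : ∀ i < N, t i ≤ t (i + 1)) {x : ℝ} (hx : x ∈ Ioo (t 0) (t N)) :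
    stepFunction N t a x = jumpSum N t a x := by
  rw [stepFunction_eq_jumpSum_sub hN x ht hx.1, unitJump_of_lt hx.2, mul_zero, sub_zero]

lemma monotoneOn_nodes {N : ℕ} {t : ℕ → ℝ} (ht : ∀ i < N, t i ≤ t (i + 1)) {i j : ℕ}
    (hij : i ≤ j) (hj : j ≤ N) : t i ≤ t j := by
  induction j, hij using Nat.le_induction with
  | base => exact le_rfl
  | succ j _ ih => exact (ih (by omega)).trans (ht j (by omega))

lemma strictMonoOn_nodes {N : ℕ} {t : ℕ → ℝ} (ht : ∀ i < N, t i < t (i + 1)) {i j : ℕ}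
    (hij : i < j) (hj : j ≤ N) : t i < t j :=
  (ht i (by omega)).trans_le (monotoneOn_nodes (fun i hi => (ht i hi).le) hij hj)

/-- The value of a sum of jumps on the `m`-th piece. -/
lemma jumpSum_eq_of_mem {N m : ℕ} {t a : ℕ → ℝ} {x : ℝ} (hm : 1 ≤ m) (hmN : m ≤ N)
    (hl : ∀ i, 1 ≤ i → i < m → t i ≤ x) (hr : ∀ i, m ≤ i → i < N → x < t i) :
    jumpSum N t a x = a m := by
  have h1 : ∑ i ∈ Finset.Ico 1 m, (a (i + 1) - a i) * unitJump (t i) x = a m - a 1 := by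
    rw [← Finset.sum_Ico_sub a hm]
    refine Finset.sum_congr rfl fun i hi => ?_
    rw [Finset.mem_Ico] at hi
    rw [unitJump_of_le (hl i hi.1 hi.2), mul_one]
  have h2 : ∑ i ∈ Finset.Ico m N, (a (i + 1) - a i) * unitJump (t i) x = 0 := by
    refine Finset.sum_eq_zero fun i hi => ?_
    rw [Finset.mem_Ico] at hi
    rw [unitJump_of_lt (hr i hi.1 hi.2), mul_zero]
  rw [jumpSum, ← Finset.sum_Ico_consecutive _ hm hmN, h1, h2]
  ring

lemma exists_jumpSum_eq {N : ℕ} (hN : 1 ≤ N) {t : ℕ → ℝ} (a : ℕ → ℝ) (x : ℝ)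
    (ht : ∀ i < N, t i ≤ t (i + 1)) :
    ∃ m, 1 ≤ m ∧ m ≤ N ∧ jumpSum N t a x = a m := by
  classical
  by_cases h : ∃ i, 1 ≤ i ∧ i < N ∧ x < t i
  · obtain ⟨h1, h2, h3⟩ := Nat.find_spec h
    refine ⟨Nat.find h, h1, h2.le, jumpSum_eq_of_mem h1 h2.le (fun i hi him => ?_)
      fun i hi hiN => h3.trans_le (monotoneOn_nodes ht hi hiN.le)⟩
    by_contra hx
    exact Nat.find_min h him ⟨hi, him.trans h2, not_le.1 hx⟩
  · push Not at h
    exact ⟨N, hN, le_rfl, jumpSum_eq_of_mem hN le_rfl h fun i h1 h2 => absurd h1 (by omega)⟩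

lemma measurable_jumpSum (N : ℕ) (t a : ℕ → ℝ) : Measurable (jumpSum N t a) :=
  measurable_const.add (Finset.measurable_sum _ fun _ _ => (measurable_unitJump _).const_mul _)

/-! ### Integrals against unit jumps -/

lemma integrable_mul_unitJump {μ : Measure ℝ} {g : ℝ → ℝ} (hg : Integrable g μ) (s : ℝ) :
    Integrable (fun x => g x * unitJump s x) μ :=
  hg.mul_bdd (measurable_unitJump s).aestronglyMeasurable
    (ae_of_all _ fun x => abs_unitJump_le s x)

lemma integral_mul_unitJump {g : ℝ → ℝ} {s : ℝ} (hs : s ∈ Icc t₀ tf) :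
    ∫ x, g x * unitJump s x ∂(intervalMeasure t₀ tf) = ∫ x in s..tf, g x := by
  have : (fun x => g x * unitJump s x) = (Ici s).indicator g := by
    ext x
    rcases le_or_gt s x with h | h
    · rw [unitJump_of_le h, indicator_of_mem (mem_Ici.2 h), mul_one]
    · rw [unitJump_of_lt h, indicator_of_notMem (by simpa using h), mul_zero]
  rw [this, intervalIntegral.integral_of_le hs.2, integral_indicator measurableSet_Ici,
    intervalMeasure, Measure.restrict_restrict measurableSet_Ici]
  refine setIntegral_congr_set ?_
  rcases hs.1.eq_or_lt with rfl | h
  · rw [inter_eq_right.2 fun x hx => hx.1.le]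
    exact Ioo_ae_eq_Ioc
  · have : Ici s ∩ Ioo t₀ tf = Ico s tf := by
      ext x; exact ⟨fun hx => ⟨hx.1, hx.2.2⟩, fun hx => ⟨hx.1, h.trans_le hx.1, hx.2⟩⟩
    rw [this]
    exact Ico_ae_eq_Ioc

/-- The oriented integral covers both orders of `r` and `s`, hence shifts to the left and to the
right at once. -/
lemma integral_mul_unitJump_sub {g : ℝ → ℝ} (hg : Integrable g (intervalMeasure t₀ tf))
    {r s : ℝ} (hr : r ∈ Icc t₀ tf) (hs : s ∈ Icc t₀ tf) :
    ∫ x, g x * (unitJump r x - unitJump s x) ∂(intervalMeasure t₀ tf) = ∫ x in r..s, g x := by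
  have hi {a b : ℝ} (ha : a ∈ Icc t₀ tf) (hb : b ∈ Icc t₀ tf) :
      IntervalIntegrable g volume a b := by
    have h : IntegrableOn g (Icc t₀ tf) volume := by
      rw [integrableOn_Icc_iff_integrableOn_Ioo]; exact hg
    exact (h.mono_set (uIcc_subset_Icc ha hb)).intervalIntegrable
  have htf : tf ∈ Icc t₀ tf := right_mem_Icc.2 (hr.1.trans hr.2)
  simp only [mul_sub]
  rw [integral_sub (integrable_mul_unitJump hg r) (integrable_mul_unitJump hg s),
    integral_mul_unitJump hr, integral_mul_unitJump hs, sub_eq_iff_eq_add,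
    intervalIntegral.integral_add_adjacent_intervals (hi hr hs) (hi hs htf)]

lemma integral_abs_unitJump_sub {r s : ℝ} (hr : r ∈ Icc t₀ tf) (hs : s ∈ Icc t₀ tf) :
    ∫ x, |unitJump r x - unitJump s x| ∂(intervalMeasure t₀ tf) = |s - r| := by
  wlog h : r ≤ s generalizing r s
  · rw [abs_sub_comm s r, ← this hs hr (le_of_not_ge h)]
    simp only [abs_sub_comm]
  have h1 := integral_mul_unitJump_sub (g := fun _ => 1) (integrable_const _) hr hs
  simp only [one_mul, intervalIntegral.integral_const, smul_eq_mul, mul_one] at h1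
  rw [abs_of_nonneg (sub_nonneg.2 h), ← h1]
  refine integral_congr_ae (ae_of_all _ fun x => abs_of_nonneg ?_)
  have := indicator_Ico_eq_unitJump_sub h 1 x
  rw [one_mul] at this
  rw [← this]
  exact indicator_nonneg (fun _ _ => zero_le_one) _

/-! ### The total variation of step functions -/

lemma IsTestFunction.eq_zero {φ : ℝ → ℝ} (hφ : IsTestFunction t₀ tf φ) {x : ℝ}
    (hx : x ∉ Ioo t₀ tf) : φ x = 0 :=
  image_eq_zero_of_notMem_tsupport fun h => hx (hφ.2.2 h)

lemma integral_jumpSum_mul_deriv (ht : t₀ ≤ tf) {N : ℕ} {t : ℕ → ℝ} (a : ℕ → ℝ)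
    (htm : ∀ i, 1 ≤ i → i < N → t i ∈ Icc t₀ tf) {φ : ℝ → ℝ} (hφ : IsTestFunction t₀ tf φ) :
    ∫ x, jumpSum N t a x * deriv φ x ∂(intervalMeasure t₀ tf) =
      -∑ i ∈ Finset.Ico 1 N, (a (i + 1) - a i) * φ (t i) := by
  have hc : Continuous (deriv φ) := hφ.1.continuous_deriv le_rfl
  have hint : Integrable (deriv φ) (intervalMeasure t₀ tf) :=
    (hc.integrable_of_hasCompactSupport hφ.2.1.deriv).restrict
  have hJ {s : ℝ} (hs : s ∈ Icc t₀ tf) :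
      ∫ x, deriv φ x * unitJump s x ∂(intervalMeasure t₀ tf) = -φ s := by
    rw [integral_mul_unitJump hs, intervalIntegral.integral_deriv_eq_sub
      (fun x _ => (hφ.1.differentiable one_ne_zero) x) (hc.intervalIntegrable _ _),
      hφ.eq_zero (by simp), zero_sub]
  have h0 : ∫ x, deriv φ x ∂(intervalMeasure t₀ tf) = 0 := by
    have := hJ (left_mem_Icc.2 ht)
    rw [hφ.eq_zero (by simp), neg_zero] at this
    rw [← this]
    refine setIntegral_congr_fun measurableSet_Ioo fun x hx => ?_
    simp only [unitJump_of_le hx.1.le, mul_one]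
  have hexp : (fun x => jumpSum N t a x * deriv φ x) = fun x => a 1 * deriv φ x +
      ∑ i ∈ Finset.Ico 1 N, (a (i + 1) - a i) * (deriv φ x * unitJump (t i) x) := by
    ext x
    rw [jumpSum, add_mul, Finset.sum_mul]
    congr 1
    exact Finset.sum_congr rfl fun i _ => by ring
  rw [hexp, integral_add (hint.const_mul _) (integrable_finsetSum _ fun i _ =>
    (integrable_mul_unitJump hint _).const_mul _), integral_const_mul, h0, mul_zero, zero_add,
    integral_finsetSum _ fun i _ => (integrable_mul_unitJump hint _).const_mul _,
    ← Finset.sum_neg_distrib]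
  refine Finset.sum_congr rfl fun i hi => ?_
  rw [Finset.mem_Ico] at hi
  rw [integral_const_mul, hJ (htm i hi.1 hi.2), mul_neg]

lemma TV_le_of_ae_eq_jumpSum (ht : t₀ ≤ tf) {v : L2 t₀ tf} {N : ℕ} {t a : ℕ → ℝ}
    (htm : ∀ i, 1 ≤ i → i < N → t i ∈ Icc t₀ tf)
    (hv : v =ᵐ[intervalMeasure t₀ tf] jumpSum N t a) :
    TV v ≤ ENNReal.ofReal (∑ i ∈ Finset.Ico 1 N, |a (i + 1) - a i|) := by
  refine iSup_le fun φ => iSup_le fun hφ => iSup_le fun h1 => ENNReal.ofReal_le_ofReal ?_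
  have : ∫ x, v x * deriv φ x ∂(intervalMeasure t₀ tf) =
      ∫ x, jumpSum N t a x * deriv φ x ∂(intervalMeasure t₀ tf) :=
    integral_congr_ae (hv.mono fun x hx => by simp only [hx])
  rw [this, integral_jumpSum_mul_deriv ht a htm hφ, ← Finset.sum_neg_distrib]
  refine Finset.sum_le_sum fun i _ => (neg_le_abs _).trans ?_
  rw [abs_mul]
  exact mul_le_of_le_one_right (abs_nonneg _) (h1 _)

/-- A test function with values in `[-1, 1]` that separates two finite subsets of `Ω`. -/
lemma exists_isTestFunction_one_neg_one {P Q : Set ℝ} (hP : P.Finite) (hQ : Q.Finite)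
    (hPs : P ⊆ Ioo t₀ tf) (hQs : Q ⊆ Ioo t₀ tf) (hPQ : Disjoint P Q) :
    ∃ φ, IsTestFunction t₀ tf φ ∧ (∀ x, |φ x| ≤ 1) ∧ (∀ x ∈ P, φ x = 1) ∧ ∀ x ∈ Q, φ x = -1 := by
  have key {A B : Set ℝ} (hA : A.Finite) (hB : B.Finite) (hAs : A ⊆ Ioo t₀ tf)
      (hAB : Disjoint A B) : ∃ f, IsTestFunction t₀ tf f ∧ (∀ x, f x ∈ Icc (0 : ℝ) 1) ∧
        (∀ x ∈ A, f x = 1) ∧ ∀ x ∈ B, f x = 0 := by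
    obtain ⟨L, hL, hAL, hLO⟩ := exists_compact_between hA.isCompact isOpen_Ioo hAs
    -- Vanishing off the interior of the compact set `L` forces the support into `L`, hence into
    -- `Ω`.
    obtain ⟨f, h0, h1, hf⟩ := exists_contMDiffMap_zero_one_of_isClosed (n := 1)
      (modelWithCornersSelf ℝ ℝ) (s := (interior L)ᶜ ∪ B)
      ((isOpen_interior (s := L)).isClosed_compl.union hB.isClosed) hA.isClosed
      (disjoint_left.2 fun x hx hxA => hx.elim (fun h => h (hAL hxA))
        fun h => disjoint_left.1 hAB hxA h)
    have hsupp : tsupport f ⊆ L := closure_minimal (fun x hx => by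
      by_contra hxL
      exact hx (h0 (Or.inl fun h => hxL (interior_subset h)))) hL.isClosed
    exact ⟨f, ⟨f.contMDiff.contDiff, hL.of_isClosed_subset (isClosed_tsupport _) hsupp,
      hsupp.trans hLO⟩, hf, fun x hx => h1 hx, fun x hx => h0 (Or.inr hx)⟩
  obtain ⟨f, hf, hf01, hf1, hf0⟩ := key hP hQ hPs hPQ
  obtain ⟨g, hg, hg01, hg1, hg0⟩ := key hQ hP hQs hPQ.symm
  refine ⟨fun x => f x - g x, ⟨hf.1.sub hg.1, hf.2.1.sub hg.2.1,
    (tsupport_sub f g).trans (union_subset hf.2.2 hg.2.2)⟩, fun x => ?_, fun x hx => ?_,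
    fun x hx => ?_⟩
  · rw [abs_le]
    constructor <;> linarith [(hf01 x).1, (hf01 x).2, (hg01 x).1, (hg01 x).2]
  · simp only [hf1 x hx, hg0 x hx, sub_zero]
  · simp only [hf0 x hx, hg1 x hx, zero_sub]

lemma le_TV_of_ae_eq_jumpSum (ht : t₀ ≤ tf) {v : L2 t₀ tf} {N : ℕ} {t a : ℕ → ℝ}
    (htm : ∀ i, 1 ≤ i → i < N → t i ∈ Ioo t₀ tf)
    (hinj : ∀ i j, 1 ≤ i → i < j → j < N → t i ≠ t j)
    (hv : v =ᵐ[intervalMeasure t₀ tf] jumpSum N t a) :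
    ENNReal.ofReal (∑ i ∈ Finset.Ico 1 N, |a (i + 1) - a i|) ≤ TV v := by
  -- Integration by parts brings a minus sign, so the optimal test function is `1` at downward jumps
  -- and `-1` at upward ones.
  obtain ⟨φ, hφ, h1, hP, hQ⟩ := exists_isTestFunction_one_neg_one (t₀ := t₀) (tf := tf)
    (P := t '' {i | (1 ≤ i ∧ i < N) ∧ a (i + 1) - a i < 0})
    (Q := t '' {i | (1 ≤ i ∧ i < N) ∧ 0 ≤ a (i + 1) - a i})
    (((finite_Ico 1 N).subset fun i hi => ⟨hi.1.1, hi.1.2⟩).image t)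
    (((finite_Ico 1 N).subset fun i hi => ⟨hi.1.1, hi.1.2⟩).image t)
    (by rintro _ ⟨i, hi, rfl⟩; exact htm i hi.1.1 hi.1.2)
    (by rintro _ ⟨i, hi, rfl⟩; exact htm i hi.1.1 hi.1.2)
    (by
      rw [disjoint_left]
      rintro _ ⟨i, hi, rfl⟩ ⟨j, hj, hij⟩
      rcases lt_trichotomy i j with h | h | h
      · exact hinj i j hi.1.1 h hj.1.2 hij.symm
      · subst h; exact absurd hi.2 (not_lt.2 hj.2)
      · exact hinj j i hj.1.1 h hi.1.2 hij)
  refine le_trans (ENNReal.ofReal_le_ofReal (le_of_eq ?_)) (ofReal_integral_le_TV v hφ h1)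
  have : ∫ x, v x * deriv φ x ∂(intervalMeasure t₀ tf) =
      ∫ x, jumpSum N t a x * deriv φ x ∂(intervalMeasure t₀ tf) :=
    integral_congr_ae (hv.mono fun x hx => by simp only [hx])
  rw [this, integral_jumpSum_mul_deriv ht a (fun i h1 h2 => Ioo_subset_Icc_self (htm i h1 h2)) hφ,
    ← Finset.sum_neg_distrib]
  refine Finset.sum_congr rfl fun i hi => ?_
  rw [Finset.mem_Ico] at hi
  rcases lt_or_ge (a (i + 1) - a i) 0 with h | h
  · rw [hP _ ⟨i, ⟨hi, h⟩, rfl⟩, abs_of_neg h, mul_one]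
  · rw [hQ _ ⟨i, ⟨hi, h⟩, rfl⟩, abs_of_nonneg h]; ring

/-! ### Moving one switching location -/

/-- Between its two neighbours, a switching location can move without changing the jump heights; `v
- w` is then the jump height times a difference of two unit jumps. -/
lemma exists_shift (ht : t₀ < tf) {v : L2 t₀ tf} {N : ℕ} {t a : ℕ → ℝ}
    (hv : IsStepRepresentation ν v N t a) {i : ℕ} (hi : 1 ≤ i) (hiN : i < N) {s : ℝ}
    (hs : s ∈ Ioo (t (i - 1)) (t (i + 1))) (g : L2 t₀ tf) :
    ∃ w : L2 t₀ tf, Feasible ν w ∧ TV w ≤ TV v ∧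
      l1Norm (w - v) = |a (i + 1) - a i| * |s - t i| ∧
      inner ℝ g (v - w) = (a (i + 1) - a i) * ∫ x in (t i)..s, g x := by
  classical
  set t' := Function.update t i s with ht'
  have hN := hv.one_le
  have hle : ∀ j < N, t j ≤ t (j + 1) := fun j hj => (hv.nodes_lt j hj).le
  have hti : t i ∈ Ioo t₀ tf := by
    rw [← hv.left_end, ← hv.right_end]
    exact ⟨strictMonoOn_nodes hv.nodes_lt (by omega) hiN.le,
      strictMonoOn_nodes hv.nodes_lt hiN le_rfl⟩
  have hmem : ∀ j ≤ N, t j ∈ Icc t₀ tf := fun j hj => by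
    rw [← hv.left_end, ← hv.right_end]
    exact ⟨monotoneOn_nodes hle (by omega) hj, monotoneOn_nodes hle hj le_rfl⟩
  have hsm : s ∈ Icc t₀ tf :=
    ⟨(hmem (i - 1) (by omega)).1.trans hs.1.le, hs.2.le.trans (hmem (i + 1) (by omega)).2⟩
  have hmem' : ∀ j ≤ N, t' j ∈ Icc t₀ tf := fun j hj => by
    rcases eq_or_ne j i with rfl | h
    · rwa [ht', Function.update_self]
    · rw [ht', Function.update_of_ne h]; exact hmem j hj
  have hle' : ∀ j < N, t' j ≤ t' (j + 1) := by
    intro j hj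
    rcases eq_or_ne j i with rfl | h
    · rw [ht', Function.update_self, Function.update_of_ne (by omega)]; exact hs.2.le
    rcases eq_or_ne (j + 1) i with rfl | h2
    · rw [ht', Function.update_self, Function.update_of_ne h]; exact hs.1.le
    · rw [ht', Function.update_of_ne h, Function.update_of_ne h2]; exact hle j hj
  have hve : v =ᵐ[intervalMeasure t₀ tf] jumpSum N t a := by
    filter_upwards [hv.eq_step, ae_restrict_mem measurableSet_Ioo] with x hx hxm
    rw [hx, stepFunction_eq_jumpSum hN hle (by rwa [hv.left_end, hv.right_end])]
  have hbd (x : ℝ) : ‖jumpSum N t' a x‖ ≤ ∑ k ∈ Finset.Icc 1 N, |a k| := by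
    obtain ⟨m, h1, h2, h3⟩ := exists_jumpSum_eq hN a x hle'
    rw [h3]
    exact Finset.single_le_sum (f := fun k => |a k|) (fun _ _ => abs_nonneg _)
      (Finset.mem_Icc.2 ⟨h1, h2⟩)
  have hLp : MemLp (jumpSum N t' a) 2 (intervalMeasure t₀ tf) :=
    MemLp.of_bound (measurable_jumpSum _ _ _).aestronglyMeasurable _ (ae_of_all _ hbd)
  have hwe := hLp.coeFn_toLp
  have hdiff (x : ℝ) : jumpSum N t a x - jumpSum N t' a x =
      (a (i + 1) - a i) * (unitJump (t i) x - unitJump s x) := by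
    rw [jumpSum, jumpSum, add_sub_add_left_eq_sub, ← Finset.sum_sub_distrib,
      Finset.sum_eq_single i]
    · rw [ht', Function.update_self]; ring
    · intro j _ hj; rw [ht', Function.update_of_ne hj, sub_self]
    · intro h; exact absurd (Finset.mem_Ico.2 ⟨hi, hiN⟩) h
  refine ⟨hLp.toLp, ?_, ?_, ?_, ?_⟩
  · filter_upwards [hwe] with x hx
    obtain ⟨m, h1, h2, h3⟩ := exists_jumpSum_eq hN a x hle'
    rw [hx, h3]
    exact hv.values m h1 h2
  · refine (TV_le_of_ae_eq_jumpSum ht.le (fun j _ hj => hmem' j hj.le) hwe).trans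
      (le_TV_of_ae_eq_jumpSum ht.le (fun j h1 h2 => ?_)
        (fun j k h1 h2 h3 => (strictMonoOn_nodes hv.nodes_lt h2 h3.le).ne) hve)
    rw [← hv.left_end, ← hv.right_end]
    exact ⟨strictMonoOn_nodes hv.nodes_lt h1 h2.le, strictMonoOn_nodes hv.nodes_lt h2 le_rfl⟩
  · rw [l1Norm_sub_comm, l1Norm, ← integral_abs_unitJump_sub (Ioo_subset_Icc_self hti) hsm,
      ← integral_const_mul]
    refine integral_congr_ae ?_
    filter_upwards [hwe, hve, Lp.coeFn_sub v hLp.toLp] with x h1 h2 h3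
    simp only [h3, Pi.sub_apply, h1, h2, hdiff, abs_mul]
  · rw [← integral_mul_unitJump_sub (L2.integrable g) (Ioo_subset_Icc_self hti) hsm,
      ← integral_const_mul, MeasureTheory.L2.inner_def]
    refine integral_congr_ae ?_
    filter_upwards [hwe, hve, Lp.coeFn_sub v hLp.toLp] with x h1 h2 h3
    simp only [h3, Pi.sub_apply, h1, h2, hdiff, RCLike.inner_apply, conj_trivial]
    ring

/-! ### Functions of bounded variation with finitely many values are step functions -/

/-- A smooth transition from `0` to `1` whose derivative is a given normalized bump. -/
lemma exists_transition (b : ContDiffBump (0 : ℝ)) :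
    ∃ G : ℝ → ℝ, ContDiff ℝ 1 G ∧ Monotone G ∧ (∀ y ≤ -b.rOut, G y = 0) ∧
      (∀ y, b.rOut ≤ y → G y = 1) ∧ ∀ y, deriv G y = b.normed volume y := by
  set ρ := b.normed (volume : Measure ℝ)
  have hc : Continuous ρ := b.continuous_normed
  have hz : ∀ y, b.rOut ≤ |y| → ρ y = 0 := fun y hy => by
    have : y ∉ Function.support ρ := by
      rw [b.support_normed_eq]
      simpa using hy
    simpa using this
  have hr := b.rOut_pos
  have hd (y : ℝ) : HasDerivAt (fun y => ∫ z in (-b.rOut)..y, ρ z) (ρ y) y :=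
    intervalIntegral.integral_hasDerivAt_right (hc.intervalIntegrable _ _)
      (hc.stronglyMeasurableAtFilter _ _) hc.continuousAt
  have hderiv : deriv (fun y => ∫ z in (-b.rOut)..y, ρ z) = ρ := funext fun y => (hd y).deriv
  refine ⟨fun y => ∫ z in (-b.rOut)..y, ρ z, ?_, ?_, fun y hy => ?_, fun y hy => ?_,
    fun y => (hd y).deriv⟩
  · rw [contDiff_one_iff_deriv, hderiv]
    exact ⟨fun y => (hd y).differentiableAt, hc⟩
  · exact monotone_of_deriv_nonneg (fun y => (hd y).differentiableAt)
      fun y => by rw [hderiv]; exact b.nonneg_normed y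
  · refine intervalIntegral.integral_zero_ae (ae_of_all _ fun z hz' => hz z ?_)
    rw [uIoc_of_ge hy] at hz'
    rw [abs_of_nonpos (by linarith [hz'.2])]
    linarith [hz'.2]
  · have h1 : ∫ z, ρ z = 1 := b.integral_normed
    simp only
    rw [intervalIntegral.integral_of_le (by linarith), ← h1]
    refine setIntegral_eq_integral_of_forall_compl_eq_zero fun z hz' => hz z ?_
    simp only [mem_Ioc, not_and_or, not_lt, not_le] at hz'
    rcases hz' with h | h
    · rw [abs_of_nonpos (by linarith)]; linarith
    · exact hy.trans (h.le.trans (le_abs_self z))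

/-- The mollification of `v`. -/
def mollify (b : ContDiffBump (0 : ℝ)) (v : L2 t₀ tf) (x : ℝ) : ℝ :=
  ∫ y, v y * b.normed volume (y - x) ∂(intervalMeasure t₀ tf)

/-- Each increment of the mollification is `v` tested with the derivative of a difference of two
translated transitions. Their combination with signs `c i` is again admissible: the differences are
nonnegative and telescope to at most `1`. -/
lemma sum_abs_mollify_sub_le {v : L2 t₀ tf} (hv : IsBV v) (b : ContDiffBump (0 : ℝ)) {n : ℕ}
    {u : ℕ → ℝ} (hu : Monotone u) (hl : t₀ < u 0 - b.rOut) (hr : u n + b.rOut < tf) :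
    ∑ i ∈ Finset.range n, |mollify b v (u (i + 1)) - mollify b v (u i)| ≤ (TV v).toReal := by
  obtain ⟨G, hG, hGm, hG0, hG1, hGd⟩ := exists_transition b
  have hro := b.rOut_pos
  have hG01 (y : ℝ) : G y ∈ Icc (0 : ℝ) 1 := by
    constructor
    · rw [← hG0 (min y (-b.rOut)) (min_le_right _ _)]
      exact hGm (min_le_left _ _)
    · rw [← hG1 (max y b.rOut) (le_max_right _ _)]
      exact hGm (le_max_left _ _)
  set c : ℕ → ℝ := fun i => SignType.sign (mollify b v (u i) - mollify b v (u (i + 1)))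
  have hc (i : ℕ) : |c i| ≤ 1 := by
    simp only [c]
    rcases lt_trichotomy (mollify b v (u i) - mollify b v (u (i + 1))) 0 with h | h | h
    · simp [sign_neg h]
    · simp [h]
    · simp [sign_pos h]
  set φ : ℝ → ℝ := fun x => ∑ i ∈ Finset.range n, c i * (G (x - u i) - G (x - u (i + 1)))
  have hφ_le (x : ℝ) : |φ x| ≤ G (x - u 0) - G (x - u n) := by
    rw [← Finset.sum_range_sub' (fun i => G (x - u i)) n]
    refine (Finset.abs_sum_le_sum_abs _ _).trans (Finset.sum_le_sum fun i _ => ?_)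
    have h0 : 0 ≤ G (x - u i) - G (x - u (i + 1)) :=
      sub_nonneg.2 (hGm (sub_le_sub_left (hu i.le_succ) x))
    rw [abs_mul, abs_of_nonneg h0]
    exact mul_le_of_le_one_left h0 (hc i)
  have hφ1 (x : ℝ) : |φ x| ≤ 1 :=
    (hφ_le x).trans (by linarith [(hG01 (x - u 0)).2, (hG01 (x - u n)).1])
  have hu0n : u 0 ≤ u n := hu (Nat.zero_le n)
  have hsupp : tsupport φ ⊆ Icc (u 0 - b.rOut) (u n + b.rOut) := by
    refine closure_minimal (fun x hx => ?_) isClosed_Icc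
    by_contra hmem
    apply hx
    have h := hφ_le x
    rw [mem_Icc, not_and_or, not_le, not_le] at hmem
    have : G (x - u 0) - G (x - u n) = 0 := by
      rcases hmem with h | h
      · rw [hG0 _ (by linarith), hG0 _ (by linarith), sub_zero]
      · rw [hG1 _ (by linarith), hG1 _ (by linarith), sub_self]
    rw [this] at h
    exact abs_eq_zero.1 (le_antisymm h (abs_nonneg _))
  have hφt : IsTestFunction t₀ tf φ := by
    refine ⟨ContDiff.sum fun i _ => contDiff_const.mul
      ((hG.comp (contDiff_id.sub contDiff_const)).sub (hG.comp (contDiff_id.sub contDiff_const))),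
      HasCompactSupport.intro isCompact_Icc fun x hx => image_eq_zero_of_notMem_tsupport
        fun h => hx (hsupp h), hsupp.trans fun x hx => ⟨hl.trans_le hx.1, hx.2.trans_lt hr⟩⟩
  have hGs (s x : ℝ) : HasDerivAt (fun x => G (x - s)) (b.normed volume (x - s)) x := by
    have h := ((hG.differentiable one_ne_zero) (x - s)).hasDerivAt
    rw [hGd] at h
    exact h.comp_sub_const x s
  have hφd (x : ℝ) : deriv φ x = ∑ i ∈ Finset.range n,
      c i * (b.normed volume (x - u i) - b.normed volume (x - u (i + 1))) :=
    (HasDerivAt.fun_sum fun i _ => ((hGs (u i) x).sub (hGs (u (i + 1)) x)).const_mul (c i)).deriv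
  have hint (s : ℝ) : Integrable (fun x => v x * b.normed volume (x - s))
      (intervalMeasure t₀ tf) := by
    obtain ⟨C, hC⟩ := b.hasCompactSupport_normed (μ := volume).exists_bound_of_continuous
      b.continuous_normed
    exact (L2.integrable v).mul_bdd
      (b.continuous_normed.comp (continuous_id.sub continuous_const)).aestronglyMeasurable
      (ae_of_all _ fun x => hC (x - s))
  have hval : ∫ x, v x * deriv φ x ∂(intervalMeasure t₀ tf) =
      ∑ i ∈ Finset.range n, c i * (mollify b v (u i) - mollify b v (u (i + 1))) := by
    have hexp : (fun x => v x * deriv φ x) = fun x => ∑ i ∈ Finset.range n, c i *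
        (v x * b.normed volume (x - u i) - v x * b.normed volume (x - u (i + 1))) := by
      ext x
      rw [hφd, Finset.mul_sum]
      exact Finset.sum_congr rfl fun i _ => by ring
    have hint' (i : ℕ) : Integrable (fun x => c i * (v x * b.normed volume (x - u i) -
        v x * b.normed volume (x - u (i + 1)))) (intervalMeasure t₀ tf) :=
      ((hint _).sub (hint _)).const_mul _
    rw [hexp, integral_finsetSum _ fun i _ => hint' i]
    refine Finset.sum_congr rfl fun i _ => ?_
    rw [integral_const_mul, integral_sub (hint _) (hint _)]
    rfl
  refine le_trans (le_of_eq ?_) (integral_le_TV_toReal hv hφt hφ1)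
  rw [hval]
  refine Finset.sum_congr rfl fun i _ => ?_
  rw [abs_sub_comm]
  exact (sign_mul_self _).symm

/-- Bump functions at the origin that shrink to a point. -/
def shrinkingBump (n : ℕ) : ContDiffBump (0 : ℝ) where
  rIn := 1 / ((n : ℝ) + 1)
  rOut := 2 * (1 / ((n : ℝ) + 1))
  rIn_pos := by positivity
  rIn_lt_rOut := by
    have : 0 < 1 / ((n : ℝ) + 1) := by positivity
    linarith

lemma tendsto_shrinkingBump_rOut :
    Tendsto (fun n => (shrinkingBump n).rOut) atTop (𝓝 0) := by
  simpa [shrinkingBump] using (tendsto_one_div_add_atTop_nhds_zero_nat (𝕜 := ℝ)).const_mul 2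

lemma ae_tendsto_mollify (v : L2 t₀ tf) : ∀ᵐ x ∂(intervalMeasure t₀ tf),
    Tendsto (fun n => mollify (shrinkingBump n) v x) atTop (𝓝 (v x)) := by
  have hloc : LocallyIntegrable ((Ioo t₀ tf).indicator v) volume :=
    ((integrable_indicator_iff measurableSet_Ioo).2 (L2.integrable v)).locallyIntegrable
  -- Lebesgue differentiation requires a bounded ratio of outer to inner radius; here it is exactly
  -- `2`.
  have := ContDiffBump.ae_convolution_tendsto_right_of_locallyIntegrable (K := 2)
    tendsto_shrinkingBump_rOut (Eventually.of_forall fun n => le_rfl) hloc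
  filter_upwards [ae_restrict_of_ae this, ae_restrict_mem measurableSet_Ioo] with x hx hxm
  rw [indicator_of_mem hxm] at hx
  refine hx.congr fun n => ?_
  rw [convolution_eq_swap, mollify, ← integral_indicator measurableSet_Ioo]
  refine integral_congr_ae (ae_of_all _ fun y => ?_)
  simp only [ContinuousLinearMap.lsmul_apply, smul_eq_mul]
  rw [← neg_sub y x, ContDiffBump.normed_neg]
  by_cases hy : y ∈ Ioo t₀ tf
  · rw [indicator_of_mem hy, indicator_of_mem hy, mul_comm]
  · rw [indicator_of_notMem hy, indicator_of_notMem hy, mul_zero]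

/-- For a fixed partition the bound for mollifications passes to the limit; eventually the bump
radius is below the distance of the partition to the ends of `Ω`. -/
lemma eVariationOn_le_of_tendsto_mollify {v : L2 t₀ tf} (hv : IsBV v) {E : Set ℝ}
    (hE : E ⊆ Ioo t₀ tf)
    (hlim : ∀ x ∈ E, Tendsto (fun n => mollify (shrinkingBump n) v x) atTop (𝓝 (v x))) :
    eVariationOn v E ≤ ENNReal.ofReal (TV v).toReal := by
  refine iSup_le fun ⟨n, u, hu, huE⟩ => ?_
  simp only [edist_dist, Real.dist_eq]
  rw [← ENNReal.ofReal_sum_of_nonneg fun _ _ => abs_nonneg _]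
  refine ENNReal.ofReal_le_ofReal ?_
  have ht : Tendsto (fun k => ∑ i ∈ Finset.range n,
      |mollify (shrinkingBump k) v (u (i + 1)) - mollify (shrinkingBump k) v (u i)|) atTop
      (𝓝 (∑ i ∈ Finset.range n, |v (u (i + 1)) - v (u i)|)) :=
    tendsto_finsetSum _ fun i _ => ((hlim _ (huE (i + 1))).sub (hlim _ (huE i))).abs
  refine le_of_tendsto ht ?_
  have h0 := sub_pos.2 (hE (huE 0)).1
  have hn := sub_pos.2 (hE (huE n)).2
  filter_upwards [tendsto_shrinkingBump_rOut.eventually_lt_const h0,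
    tendsto_shrinkingBump_rOut.eventually_lt_const hn] with k h1 h2
  exact sum_abs_mollify_sub_le hv _ hu (by linarith) (by linarith)

/-- A function of bounded variation whose distinct values have distance at least `1` can only
change its value across finitely many points. -/
lemma exists_finset_switching {f : ℝ → ℝ} {E : Set ℝ} (hf : eVariationOn f E ≠ ⊤)
    (hgap : ∀ x ∈ E, ∀ y ∈ E, f x ≠ f y → 1 ≤ |f x - f y|) :
    ∃ S : Finset ℝ, ∀ x ∈ E, ∀ y ∈ E, x < y → f x ≠ f y → ∃ s ∈ S, x ≤ s ∧ s ≤ y := by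
  have hfin (z : ℝ) : eVariationOn f (E ∩ Iic z) ≠ ⊤ :=
    ne_top_of_le_ne_top hf (eVariationOn.mono f inter_subset_left)
  -- The accumulated variation rises by at least `1` across every change of value, so it passes an
  -- integer level there. The places where the finitely many levels are reached form `S`.
  set p : ℝ → ℝ := fun z => (eVariationOn f (E ∩ Iic z)).toReal with hp
  have hmono : Monotone p := fun x y hxy =>
    ENNReal.toReal_mono (hfin y)
      (eVariationOn.mono f (inter_subset_inter_right _ (Iic_subset_Iic.2 hxy)))
  have hjump : ∀ x ∈ E, ∀ y ∈ E, x < y → f x ≠ f y → p x + 1 ≤ p y := by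
    intro x hx y hy hxy hne
    have h1 : eVariationOn f (E ∩ Iic x) + eVariationOn f {x, y} ≤ eVariationOn f (E ∩ Iic y) := by
      refine (eVariationOn.add_le_union f ?_).trans (eVariationOn.mono f ?_)
      · rintro a ha b (rfl | rfl)
        · exact ha.2
        · exact le_trans ha.2 hxy.le
      · rintro a (ha | rfl | rfl)
        · exact ⟨ha.1, le_trans ha.2 hxy.le⟩
        · exact ⟨hx, hxy.le⟩
        · exact ⟨hy, mem_Iic.2 le_rfl⟩
    have h2 : 1 ≤ eVariationOn f {x, y} := by
      refine le_trans ?_ (eVariationOn.edist_le f (mem_insert x _) (mem_insert_of_mem x rfl))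
      rw [edist_dist, Real.dist_eq, ← ENNReal.ofReal_one]
      exact ENNReal.ofReal_le_ofReal (hgap x hx y hy hne)
    have h3 := ENNReal.toReal_mono (hfin y) ((add_le_add_right h2 _).trans h1)
    rwa [ENNReal.toReal_add (hfin x) ENNReal.one_ne_top, ENNReal.toReal_one] at h3
  set K := ⌊(eVariationOn f E).toReal⌋₊
  refine ⟨(Finset.range (K + 1)).image fun k : ℕ => sSup {z ∈ E | p z < k + 1},
    fun x hx y hy hxy hne => ?_⟩
  have hpx : 0 ≤ p x := ENNReal.toReal_nonneg
  have hkx : p x < ⌊p x⌋₊ + 1 := Nat.lt_floor_add_one _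
  have hky : (⌊p x⌋₊ : ℝ) + 1 ≤ p y :=
    (add_le_add_left (Nat.floor_le hpx) 1).trans (hjump x hx y hy hxy hne)
  have hub : ∀ z ∈ {z ∈ E | p z < (⌊p x⌋₊ : ℝ) + 1}, z ≤ y := by
    intro z hz
    by_contra! hyz
    exact absurd (hky.trans (hmono hyz.le)) (not_le.2 hz.2)
  refine ⟨_, Finset.mem_image.2 ⟨⌊p x⌋₊, Finset.mem_range.2 (Nat.lt_succ_of_le ?_), rfl⟩,
    le_csSup ⟨y, hub⟩ ⟨hx, hkx⟩, csSup_le ⟨x, hx, hkx⟩ hub⟩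
  exact Nat.floor_le_floor (ENNReal.toReal_mono hf (eVariationOn.mono f inter_subset_left))

/-- A function that only changes its value across finitely many points is a step function, and
superfluous switching locations can be left out. -/
lemma exists_jumpSum_of_switching {f : ℝ → ℝ} {t₀ : ℝ} (S : Finset ℝ) :
    ∀ (tf : ℝ) (E : Set ℝ), t₀ < tf → E ⊆ Ioo t₀ tf →
      (∀ a b, t₀ ≤ a → a < b → b ≤ tf → ∃ e ∈ E, a < e ∧ e < b) →
      (∀ s ∈ S, s ∈ Ioo t₀ tf ∧ s ∉ E) →
      (∀ x ∈ E, ∀ y ∈ E, x < y → f x ≠ f y → ∃ s ∈ S, x ≤ s ∧ s ≤ y) →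
      ∃ (N : ℕ) (t a : ℕ → ℝ), 1 ≤ N ∧ t 0 = t₀ ∧ t N = tf ∧ (∀ i < N, t i < t (i + 1)) ∧
        (∀ i, 1 ≤ i → i ≤ N → ∃ e ∈ E, a i = f e) ∧ (∀ i, 1 ≤ i → i < N → a i ≠ a (i + 1)) ∧
        ∀ x ∈ E, f x = jumpSum N t a x := by
  classical
  -- The largest candidate `s` is split off: the induction hypothesis applies on `(t₀, s)`, and `f`
  -- is constant on the points of `E` beyond `s`.
  induction S using Finset.induction_on_max with
  | empty =>
    intro tf E ht hE hd _ hc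
    obtain ⟨e, he, -⟩ := hd t₀ tf le_rfl ht le_rfl
    have hconst : ∀ x ∈ E, f x = f e := fun x hx => by
      by_contra hne
      rcases lt_trichotomy x e with h | h | h
      · simpa using hc x hx e he h hne
      · exact hne (by rw [h])
      · simpa using hc e he x hx h (Ne.symm hne)
    refine ⟨1, fun i => if i = 0 then t₀ else tf, fun _ => f e, le_rfl, by simp, by simp, ?_,
      fun i _ _ => ⟨e, he, rfl⟩, fun i h1 h2 => absurd h1 (by omega), fun x hx => ?_⟩
    · intro i hi
      obtain rfl : i = 0 := by omega
      simpa using ht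
    · simp [jumpSum, hconst x hx]
  | insert s S hmax ih =>
    intro tf E ht hE hd hS hc
    have hs := (hS s (Finset.mem_insert_self s S)).1
    have hsE := (hS s (Finset.mem_insert_self s S)).2
    obtain ⟨N, t, a, hN, h0, hNs, hlt, hval, hj, hf⟩ := ih s (E ∩ Iio s) hs.1
      (fun x hx => ⟨(hE hx.1).1, hx.2⟩)
      (fun c b hc hcb hb => by
        obtain ⟨e, he, h1, h2⟩ := hd c b hc hcb (hb.trans hs.2.le)
        exact ⟨e, ⟨he, h2.trans_le hb⟩, h1, h2⟩)
      (fun r hr => ⟨⟨(hS r (Finset.mem_insert_of_mem hr)).1.1, hmax r hr⟩,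
        fun h => (hS r (Finset.mem_insert_of_mem hr)).2 h.1⟩)
      (fun x hx y hy hxy hne => by
        obtain ⟨r, hr, h1, h2⟩ := hc x hx.1 y hy.1 hxy hne
        rcases Finset.mem_insert.1 hr with rfl | hr
        · exact absurd hy.2 (not_lt.2 h2)
        · exact ⟨r, hr, h1, h2⟩)
    obtain ⟨e, he, hse, -⟩ := hd s tf hs.1.le hs.2 le_rfl
    have hconst : ∀ x ∈ E, s < x → f x = f e := by
      have key : ∀ x ∈ E, ∀ y ∈ E, s < x → x < y → f x = f y := fun x hx y hy hsx hxy => by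
        by_contra hne
        obtain ⟨r, hr, h1, -⟩ := hc x hx y hy hxy hne
        rcases Finset.mem_insert.1 hr with rfl | hr
        · exact absurd hsx (not_lt.2 h1)
        · exact absurd (hsx.trans_le h1) (not_lt.2 (hmax r hr).le)
      intro x hx hsx
      rcases lt_trichotomy x e with h | h | h
      · exact key x hx e he hsx h
      · rw [h]
      · exact (key e he x hx hse h).symm
    have hlast : ∀ x, s < x → jumpSum N t a x = a N := fun x hx =>
      jumpSum_eq_of_mem hN le_rfl (fun i _ hi => (strictMonoOn_nodes hlt hi le_rfl).le.trans
        (hNs.le.trans hx.le)) fun i h1 h2 => absurd h1 (not_le.2 h2)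
    have hsplit : ∀ x ∈ E, x < s ∨ s < x := fun x hx =>
      lt_or_gt_of_ne fun h => hsE (h ▸ hx)
    -- If the value does not change at `s`, the last piece is extended to `tf`; otherwise `s`
    -- becomes a genuine node.
    by_cases hcN : f e = a N
    · have hjs : jumpSum N (Function.update t N tf) a = jumpSum N t a := by
        ext x
        unfold jumpSum
        congr 1
        refine Finset.sum_congr rfl fun i hi => ?_
        rw [Finset.mem_Ico] at hi
        rw [Function.update_of_ne hi.2.ne]
      refine ⟨N, Function.update t N tf, a, hN, ?_, Function.update_self .., ?_, ?_, hj, ?_⟩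
      · rw [Function.update_of_ne (by omega), h0]
      · intro i hi
        rw [Function.update_of_ne hi.ne]
        rcases eq_or_ne (i + 1) N with rfl | h
        · rw [Function.update_self]
          exact (hlt i hi).trans (hNs ▸ hs.2)
        · rw [Function.update_of_ne h]; exact hlt i hi
      · intro i h1 h2
        obtain ⟨z, hz, hz'⟩ := hval i h1 h2
        exact ⟨z, hz.1, hz'⟩
      · intro x hx
        rw [hjs]
        rcases hsplit x hx with h | h
        · exact hf x ⟨hx, h⟩
        · rw [hlast x h, hconst x hx h, hcN]
    · have hjs (x : ℝ) : jumpSum (N + 1) (Function.update t (N + 1) tf)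
          (Function.update a (N + 1) (f e)) x =
          jumpSum N t a x + (f e - a N) * unitJump s x := by
        unfold jumpSum
        rw [Finset.sum_Ico_succ_top hN, Function.update_of_ne (by omega : 1 ≠ N + 1),
          Function.update_self, Function.update_of_ne (by omega : N ≠ N + 1),
          Function.update_of_ne (by omega : N ≠ N + 1), hNs, ← add_assoc]
        congr 2
        refine Finset.sum_congr rfl fun i hi => ?_
        rw [Finset.mem_Ico] at hi
        rw [Function.update_of_ne (by omega), Function.update_of_ne (by omega),
          Function.update_of_ne (by omega)]
      refine ⟨N + 1, Function.update t (N + 1) tf, Function.update a (N + 1) (f e), by omega, ?_,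
        Function.update_self .., ?_, ?_, ?_, ?_⟩
      · rw [Function.update_of_ne (by omega), h0]
      · intro i hi
        rw [Function.update_of_ne hi.ne]
        rcases eq_or_ne i N with rfl | h
        · rw [Function.update_self, hNs]; exact hs.2
        · rw [Function.update_of_ne (by omega)]; exact hlt i (by omega)
      · intro i h1 h2
        rcases eq_or_ne i (N + 1) with rfl | h
        · rw [Function.update_self]; exact ⟨e, he, rfl⟩
        · obtain ⟨z, hz, hz'⟩ := hval i h1 (by omega)
          rw [Function.update_of_ne h]
          exact ⟨z, hz.1, hz'⟩
      · intro i h1 h2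
        rw [Function.update_of_ne h2.ne]
        rcases eq_or_ne i N with rfl | h
        · rw [Function.update_self]; exact Ne.symm hcN
        · rw [Function.update_of_ne (by omega)]; exact hj i h1 (by omega)
      · intro x hx
        rw [hjs]
        rcases hsplit x hx with h | h
        · rw [unitJump_of_lt h, mul_zero, add_zero]; exact hf x ⟨hx, h⟩
        · rw [unitJump_of_le h.le, hlast x h, hconst x hx h]; ring

/-- On the full-measure set of points with admissible value and convergent mollification, the
variation is finite, and distinct integers differ by at least `1`. Removing the finitely many
switching points keeps full measure, hence density. -/
theorem exists_isStepRepresentation (ht : t₀ < tf) {v : L2 t₀ tf} (hv : Feasible ν v)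
    (hBV : IsBV v) : ∃ (N : ℕ) (t a : ℕ → ℝ), IsStepRepresentation ν v N t a := by
  classical
  set E : Set ℝ := {x | x ∈ Ioo t₀ tf ∧ (∃ i, v x = (ν i : ℝ)) ∧
    Tendsto (fun n => mollify (shrinkingBump n) v x) atTop (𝓝 (v x))}
  have hEae : ∀ᵐ x ∂(intervalMeasure t₀ tf), x ∈ E := by
    filter_upwards [hv, ae_tendsto_mollify v, ae_restrict_mem measurableSet_Ioo] with x h1 h2 h3
    exact ⟨h3, h1, h2⟩
  have hvar : eVariationOn v E ≠ ⊤ := ne_top_of_le_ne_top ENNReal.ofReal_ne_top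
    (eVariationOn_le_of_tendsto_mollify hBV (fun x hx => hx.1) fun x hx => hx.2.2)
  obtain ⟨S, hS⟩ := exists_finset_switching hvar fun x hx y hy hne => by
    obtain ⟨i, hi⟩ := hx.2.1
    obtain ⟨j, hj⟩ := hy.2.1
    rw [hi, hj] at hne ⊢
    have : ν i - ν j ≠ 0 := sub_ne_zero.2 fun h => hne (by rw [h])
    exact_mod_cast Int.one_le_abs this
  have hE'ae : ∀ᵐ x ∂(intervalMeasure t₀ tf), x ∈ E \ S := by
    filter_upwards [hEae, ae_restrict_of_ae (S.finite_toSet.measure_zero volume |>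
      measure_eq_zero_iff_ae_notMem.1)] with x h1 h2
    exact ⟨h1, h2⟩
  obtain ⟨N, t, a, hN, h0, hNt, hlt, hval, hj, hf⟩ := exists_jumpSum_of_switching (f := v)
    (S.filter fun s => s ∈ Ioo t₀ tf) tf (E \ S) ht (fun x hx => hx.1.1)
    (fun c b hc hcb hb => by
      by_contra! hne
      have hsub : Ioo c b ⊆ Ioo t₀ tf := Ioo_subset_Ioo hc hb
      have h1 : ∀ᵐ x ∂(volume.restrict (Ioo c b)), x ∈ E \ S :=
        ae_restrict_of_ae_restrict_of_subset hsub hE'ae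
      have h2 : ∀ᵐ x ∂(volume.restrict (Ioo c b)), False := by
        filter_upwards [h1, ae_restrict_mem measurableSet_Ioo] with x hx hxm
        exact absurd hxm.2 (not_lt.2 (hne x hx hxm.1))
      rw [ae_iff] at h2
      simp only [not_false_eq_true, ofPred_true, Measure.restrict_apply_univ, Real.volume_Ioo,
        ENNReal.ofReal_eq_zero] at h2
      linarith)
    (fun s hs => ⟨(Finset.mem_filter.1 hs).2, fun h => h.2 (Finset.mem_filter.1 hs).1⟩)
    (fun x hx y hy hxy hne => by
      obtain ⟨s, hs, h1, h2⟩ := hS x hx.1 y hy.1 hxy hne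
      exact ⟨s, Finset.mem_filter.2 ⟨hs, hx.1.1.1.trans_le h1, h2.trans_lt hy.1.1.2⟩, h1, h2⟩)
  refine ⟨N, t, a, hN, h0, hNt, hlt, fun i h1 h2 => ?_, hj, ?_⟩
  · obtain ⟨e, he, hae⟩ := hval i h1 h2
    obtain ⟨j, hj⟩ := he.1.2.1
    exact ⟨j, hae.trans hj⟩
  · filter_upwards [hE'ae] with x hx
    rw [hf x hx, stepFunction_eq_jumpSum hN (fun i hi => (hlt i hi).le)
      (by rw [h0, hNt]; exact hx.1.1)]

/-! ### Descent at points that are not L-stationary -/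

lemma exists_le_neg_mul_of_limsup_neg {I : ℝ → ℝ}
    (h : limsup (fun h : ℝ => ((1 / h * I h : ℝ) : EReal)) (𝓝[>] 0) < 0) :
    ∃ r > 0, ∀ᶠ h in 𝓝[>] (0 : ℝ), I h ≤ -(r * h) := by
  obtain ⟨y, hy, hy0⟩ := EReal.exists_between_coe_real h
  refine ⟨-y, neg_pos.2 (EReal.coe_neg'.1 hy0), ?_⟩
  filter_upwards [eventually_lt_of_limsup_lt hy, self_mem_nhdsWithin] with h hh hpos
  have h1 := EReal.coe_lt_coe_iff.1 hh
  rw [one_div, inv_mul_lt_iff₀ hpos] at h1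
  linarith

lemma exists_mul_le_of_liminf_pos {I : ℝ → ℝ}
    (h : 0 < liminf (fun h : ℝ => ((1 / h * I h : ℝ) : EReal)) (𝓝[>] 0)) :
    ∃ r > 0, ∀ᶠ h in 𝓝[>] (0 : ℝ), r * h ≤ I h := by
  obtain ⟨y, hy0, hy⟩ := EReal.exists_between_coe_real h
  refine ⟨y, EReal.coe_pos.1 hy0, ?_⟩
  filter_upwards [eventually_lt_of_lt_liminf hy, self_mem_nhdsWithin] with h hh hpos
  have h1 := EReal.coe_lt_coe_iff.1 hh
  rw [one_div, lt_inv_mul_iff₀ hpos] at h1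
  linarith

/-- If the Dini conditions fail at the switching location `s` with jump `J`, then moving `s` to
the left or to the right yields linear descent. -/
lemma exists_direction_of_dini_fails (g : L2 t₀ tf) (s : ℝ) {c d : ℝ} (hcd : c ≠ d)
    (h : ¬((c < d → 0 ≤ upperLeftDini g s ∧ lowerRightDini g s ≤ 0) ∧
      (d < c → lowerLeftDini g s ≤ 0 ∧ 0 ≤ upperRightDini g s))) :
    ∃ e : ℝ, |e| = 1 ∧ ∃ r > 0, ∀ᶠ h in 𝓝[>] (0 : ℝ),
      r * h ≤ (d - c) * ∫ x in s..(s + e * h), g x := by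
  have left : (∃ r > 0, ∀ᶠ h in 𝓝[>] (0 : ℝ), r * h ≤ -((d - c) * ∫ x in (s - h)..s, g x)) →
      ∃ e : ℝ, |e| = 1 ∧ ∃ r > 0, ∀ᶠ h in 𝓝[>] (0 : ℝ),
        r * h ≤ (d - c) * ∫ x in s..(s + e * h), g x := by
    rintro ⟨r, hr, h⟩
    refine ⟨-1, by simp, r, hr, h.mono fun h hh => ?_⟩
    rwa [intervalIntegral.integral_symm, neg_one_mul, ← sub_eq_add_neg, mul_neg]
  have right : (∃ r > 0, ∀ᶠ h in 𝓝[>] (0 : ℝ), r * h ≤ (d - c) * ∫ x in s..(s + h), g x) →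
      ∃ e : ℝ, |e| = 1 ∧ ∃ r > 0, ∀ᶠ h in 𝓝[>] (0 : ℝ),
        r * h ≤ (d - c) * ∫ x in s..(s + e * h), g x := by
    rintro ⟨r, hr, h⟩
    exact ⟨1, by simp, r, hr, h.mono fun h hh => by rwa [one_mul]⟩
  rcases lt_or_gt_of_ne hcd with hlt | hlt
  · have hJ : 0 < d - c := sub_pos.2 hlt
    have h' : ¬(0 ≤ upperLeftDini g s ∧ lowerRightDini g s ≤ 0) := fun h' =>
      h ⟨fun _ => h', fun h'' => absurd h'' hlt.not_gt⟩
    rw [not_and_or, not_le, not_le] at h'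
    rcases h' with h' | h'
    · obtain ⟨r, hr, hh⟩ := exists_le_neg_mul_of_limsup_neg h'
      exact left ⟨(d - c) * r, mul_pos hJ hr, hh.mono fun h hh => by nlinarith⟩
    · obtain ⟨r, hr, hh⟩ := exists_mul_le_of_liminf_pos h'
      exact right ⟨(d - c) * r, mul_pos hJ hr, hh.mono fun h hh => by nlinarith⟩
  · have hJ : 0 < c - d := sub_pos.2 hlt
    have h' : ¬(lowerLeftDini g s ≤ 0 ∧ 0 ≤ upperRightDini g s) := fun h' =>
      h ⟨fun h'' => absurd h'' hlt.not_gt, fun _ => h'⟩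
    rw [not_and_or, not_le, not_le] at h'
    rcases h' with h' | h'
    · obtain ⟨r, hr, hh⟩ := exists_mul_le_of_liminf_pos h'
      exact left ⟨(c - d) * r, mul_pos hJ hr, hh.mono fun h hh => by nlinarith⟩
    · obtain ⟨r, hr, hh⟩ := exists_le_neg_mul_of_limsup_neg h'
      exact right ⟨(c - d) * r, mul_pos hJ hr, hh.mono fun h hh => by nlinarith⟩

lemma exists_descent_of_not_LStationary (ht : t₀ < tf) {F : L2 t₀ tf → ℝ} {v : L2 t₀ tf}
    (hv : Feasible ν v) (hBV : IsBV v) (hL : ¬LStationary ν F v) :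
    ∃ c > 0, ∃ D > 0, ∀ Δ, 0 < Δ → Δ < D → ∃ w : L2 t₀ tf, Feasible ν w ∧ TV w ≤ TV v ∧
      l1Norm (w - v) ≤ Δ / 2 ∧ c * Δ ≤ inner ℝ (gradient F v) (v - w) := by
  obtain ⟨N, t, a, hrep⟩ := exists_isStepRepresentation ht hv hBV
  have h : ¬∀ i, 1 ≤ i → i < N →
      (a i < a (i + 1) →
        0 ≤ upperLeftDini (gradient F v) (t i) ∧ lowerRightDini (gradient F v) (t i) ≤ 0) ∧
      (a (i + 1) < a i →
        lowerLeftDini (gradient F v) (t i) ≤ 0 ∧ 0 ≤ upperRightDini (gradient F v) (t i)) :=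
    fun h => hL ⟨hv, hBV, N, t, a, hrep, h⟩
  simp only [not_forall] at h
  obtain ⟨i, hi, hiN, h⟩ := h
  have hne := hrep.jumps i hi hiN
  have hJ : 0 < |a (i + 1) - a i| := abs_pos.2 (sub_ne_zero.2 hne.symm)
  obtain ⟨e, he, r, hr, hev⟩ := exists_direction_of_dini_fails _ _ hne h
  have hmem : t i ∈ Ioo (t (i - 1)) (t (i + 1)) :=
    ⟨strictMonoOn_nodes hrep.nodes_lt (by omega) hiN.le, hrep.nodes_lt i hiN⟩
  have hcont : Tendsto (fun h : ℝ => t i + e * h) (𝓝[>] 0) (𝓝 (t i)) := by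
    have : Continuous fun h : ℝ => t i + e * h := by fun_prop
    simpa using (this.tendsto 0).mono_left nhdsWithin_le_nhds
  obtain ⟨δ, hδ, hδ'⟩ := mem_nhdsGT_iff_exists_Ioo_subset.1
    (hev.and (hcont.eventually (isOpen_Ioo.mem_nhds hmem)))
  -- The shift `h = Δ / (2 |J|)`, with `J` the jump height, costs exactly `Δ / 2` in `L¹`. The other
  -- half of the radius is left for the distance from `v` to a nearby iterate.
  refine ⟨r / (2 * |a (i + 1) - a i|), by positivity, 2 * |a (i + 1) - a i| * δ,
    mul_pos (by positivity) hδ, fun Δ hΔ hΔD => ?_⟩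
  have hmemh : Δ / (2 * |a (i + 1) - a i|) ∈ Ioo 0 δ := by
    refine ⟨by positivity, ?_⟩
    rw [div_lt_iff₀ (by positivity)]
    linarith
  obtain ⟨h1, h2⟩ := hδ' hmemh
  obtain ⟨w, hw, hTV, hl1, hinner⟩ := exists_shift ht hrep hi hiN h2 (gradient F v)
  refine ⟨w, hw, hTV, le_of_eq ?_, ?_⟩
  · rw [hl1, add_sub_cancel_left, abs_mul, he, one_mul, abs_of_pos hmemh.1]
    field_simp
  · rw [hinner]
    refine le_trans (le_of_eq ?_) h1
    ring

/-! ### Acceptance of steps near points that are not L-stationary -/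

lemma trObjective_eq_neg_pred (α : ℝ) (F : L2 t₀ tf → ℝ) (v w : L2 t₀ tf) :
    trObjective α v (gradient F v) w = -pred α F v w := by
  rw [trObjective, pred, ← neg_sub v w, inner_neg_right]
  ring

/-- Near a point that is not L-stationary, there are a radius of the inner loop and a bound
`η > 0` such that every minimizer for this or a larger radius has a predicted reduction of at
least `η`, and the candidate for this radius is not rejected. -/
lemma exists_radius_not_rejected (ht : t₀ < tf) {α σ Δ₀ : ℝ} (hα : 0 < α) (hΔ₀ : 0 < Δ₀)
    (hσ : σ ∈ Ioo (0 : ℝ) 1) {F : L2 t₀ tf → ℝ} (hF : ContDiff ℝ 2 F) {v : L2 t₀ tf}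
    (hv : Feasible ν v) (hBV : IsBV v)
    (hH : ∃ C : ℝ, 0 < C ∧ ∀ u w : L2 t₀ tf,
      |fderiv ℝ (fderiv ℝ F) v u w| ≤ C * l1Norm u * l1Norm w)
    (hL : ¬LStationary ν F v) {u : ℕ → L2 t₀ tf} (hu : ∀ n, Feasible ν (u n))
    (huBV : ∀ n, IsBV (u n)) (hlim : Tendsto (fun n => l1Norm (u n - v)) atTop (𝓝 0)) :
    ∃ k : ℕ, ∃ η > 0, ∀ᶠ n in atTop,
      (∀ w, ¬RejectedStep α σ ν F (u n) (Δ₀ / 2 ^ k) w) ∧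
      ∀ K ≤ k, ∀ w, IsTRMinimizer α ν (u n) (gradient F (u n)) (Δ₀ / 2 ^ K) w →
        η ≤ pred α F (u n) w := by
  obtain ⟨c, hc, D, hD, hdesc⟩ := exists_descent_of_not_LStationary ht hv hBV hL
  have h1σ : 0 < 1 - σ := sub_pos.2 hσ.2
  obtain ⟨ρ, hρ, hrem⟩ := exists_remainder_bound hF v hv hH
    (ε := (1 - σ) * (c / 2)) (by positivity)
  have hrad : Tendsto (fun k : ℕ => Δ₀ / 2 ^ k) atTop (𝓝 0) :=
    tendsto_const_nhds.div_atTop (tendsto_pow_atTop_atTop_of_one_lt one_lt_two)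
  obtain ⟨k, hkD, hkρ⟩ :=
    ((hrad.eventually_lt_const hD).and (hrad.eventually_lt_const hρ)).exists
  set Δ := Δ₀ / 2 ^ k
  have hΔ : 0 < Δ := by positivity
  obtain ⟨w, hw, hTV, hl1, hin⟩ := hdesc Δ hΔ hkD
  have hwBV : IsBV w := lt_of_le_of_lt hTV hBV
  have hL2 := tendsto_of_l1Norm_tendsto hu hv hlim
  have hgrad : Tendsto (fun n => inner ℝ (gradient F (u n)) (u n - w)) atTop
      (𝓝 (inner ℝ (gradient F v) (v - w))) := by
    have hcg : Continuous (fderiv ℝ F) := hF.continuous_fderiv two_ne_zero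
    simp only [inner_gradient]
    have : Continuous fun x => fderiv ℝ F x (x - w) :=
      hcg.clm_apply (continuous_id.sub continuous_const)
    exact (this.tendsto v).comp hL2
  have hTVw : (TV w).toReal ≤ (TV v).toReal := ENNReal.toReal_mono hBV.ne hTV
  refine ⟨k, c / 2 * Δ, by positivity, ?_⟩
  -- The competitor `w` built at `v` loses at most `c Δ / 4` in the gradient term and `c Δ / 4` in
  -- the total variation, leaving a predicted reduction of `c Δ / 2`.
  filter_upwards [hgrad.eventually_const_lt (u := 3 / 4 * (c * Δ)) (by nlinarith [mul_pos hc hΔ]),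
    eventually_lt_TV_toReal huBV hBV hlim (b := (TV v).toReal - c * Δ / (4 * α))
      (sub_lt_self _ (by positivity)),
    hlim.eventually_lt_const (half_pos hΔ), hlim.eventually_lt_const hρ] with n h1 h2 h3 h4
  have hpw : c / 2 * Δ ≤ pred α F (u n) w := by
    have h5 : α * (TV w).toReal - c * Δ / 4 ≤ α * (TV (u n)).toReal := by
      have := mul_le_mul_of_nonneg_left (h2.le.trans' (sub_le_sub_right hTVw _)) hα.le
      refine le_trans (le_of_eq ?_) this
      field_simp
    unfold pred
    linarith
  have hwr : l1Norm (w - u n) ≤ Δ := by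
    have := l1Norm_sub_le w v (u n)
    rw [l1Norm_sub_comm v (u n)] at this
    linarith
  have hmin : ∀ K ≤ k, ∀ w', IsTRMinimizer α ν (u n) (gradient F (u n)) (Δ₀ / 2 ^ K) w' →
      c / 2 * Δ ≤ pred α F (u n) w' := by
    intro K hK w' hw'
    have hle : Δ ≤ Δ₀ / 2 ^ K :=
      div_le_div_of_nonneg_left hΔ₀.le (by positivity) (pow_le_pow_right₀ one_le_two hK)
    have := hw'.2 w hw hwBV (hwr.trans hle)
    rw [trObjective_eq_neg_pred, trObjective_eq_neg_pred] at this
    linarith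
  refine ⟨fun w' hrej => ?_, hmin⟩
  obtain ⟨hw'min, -, hared⟩ := hrej
  have hp := hmin k le_rfl w' hw'min
  have hr := hrem (u n) w' (hu n) hw'min.1.1 h4.le (hw'min.1.2.2.trans hkρ.le)
  have hr' := (le_abs_self _).trans
    (hr.trans (mul_le_mul_of_nonneg_left hw'min.1.2.2 (by positivity)))
  -- The total variation enters both reductions identically, so they differ only by the Taylor
  -- remainder. That is at most `(1 - σ) c Δ / 2 ≤ (1 - σ) pred`, which contradicts rejection.
  have hared' : ared α F (u n) w' = pred α F (u n) w' -
      (F w' - F (u n) - fderiv ℝ F (u n) (w' - u n)) := by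
    rw [ared, pred, inner_gradient, ← neg_sub w' (u n), map_neg]
    ring
  have := mul_le_mul_of_nonneg_left hp h1σ.le
  rw [hared'] at hared
  linarith

/-! ### Convergence -/

lemma InnerLoopAccepts.feasible {α σ Δ₀ : ℝ} {F : L2 t₀ tf → ℝ} {v v' : L2 t₀ tf}
    (h : InnerLoopAccepts α σ Δ₀ ν F v v') : Feasible ν v' ∧ IsBV v' := by
  obtain ⟨K, w, -, h⟩ := h
  exact ⟨h.1.1.1, h.1.1.2.1⟩

lemma LStationary_of_final {α σ Δ₀ : ℝ} (ht : t₀ < tf) (hα : 0 < α) (hΔ₀ : 0 < Δ₀)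
    (hσ : σ ∈ Ioo (0 : ℝ) 1) {F : L2 t₀ tf → ℝ} (hF : ContDiff ℝ 2 F) {v : L2 t₀ tf}
    (hv : Feasible ν v) (hBV : IsBV v)
    (hH : ∃ C : ℝ, 0 < C ∧ ∀ u w : L2 t₀ tf,
      |fderiv ℝ (fderiv ℝ F) v u w| ≤ C * l1Norm u * l1Norm w)
    (h : InnerLoopTerminates α σ Δ₀ ν F v ∨ InnerLoopRunsForever α σ Δ₀ ν F v) :
    LStationary ν F v := by
  by_contra hL
  -- The radius result is applied to the constant sequence `v`.
  have hlim : Tendsto (fun _ : ℕ => l1Norm (v - v)) atTop (𝓝 0) := by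
    have : l1Norm (v - v) = 0 := by
      refine (integral_congr_ae ?_).trans (integral_zero _ _)
      filter_upwards [Lp.coeFn_sub v v] with x hx
      rw [hx, Pi.sub_apply, sub_self, abs_zero]
    simp only [this]
    exact tendsto_const_nhds
  obtain ⟨k, η, hη, hev⟩ := exists_radius_not_rejected ht hα hΔ₀ hσ hF hv hBV hH hL
    (fun _ => hv) (fun _ => hBV) hlim
  obtain ⟨n, hnr, hmin⟩ := hev.exists
  rcases h with ⟨K, w, hrej, hterm, hpred⟩ | ⟨w, hrej⟩
  · rcases lt_or_ge k K with h | h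
    · exact hnr _ (hrej k h)
    · exact absurd (hmin K h _ hterm) (not_le.2 (hpred.trans_lt hη))
  · exact hnr _ (hrej k)

lemma LStationary_of_infinite {α σ Δ₀ : ℝ} (ht : t₀ < tf) (hα : 0 < α) (hΔ₀ : 0 < Δ₀)
    (hσ : σ ∈ Ioo (0 : ℝ) 1) {F : L2 t₀ tf → ℝ} (hF : ContDiff ℝ 2 F)
    (hbdd : BddBelow (range F)) {v : ℕ → L2 t₀ tf} (hv : ∀ n, Feasible ν (v n))
    (hBV : ∀ n, IsBV (v n)) (hacc : ∀ n, InnerLoopAccepts α σ Δ₀ ν F (v n) (v (n + 1)))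
    {s : ℕ → ℕ} (hs : StrictMono s) {w : L2 t₀ tf} (hwBV : IsBV w)
    (hlim : Tendsto (fun n => l1Norm (v (s n) - w)) atTop (𝓝 0))
    (hH : ∃ C : ℝ, 0 < C ∧ ∀ u u' : L2 t₀ tf,
      |fderiv ℝ (fderiv ℝ F) w u u'| ≤ C * l1Norm u * l1Norm u') :
    LStationary ν F w := by
  by_contra hL
  have hw : Feasible ν w := feasible_of_l1Norm_tendsto (fun n => hv (s n)) hlim
  obtain ⟨k, η, hη, hev⟩ := exists_radius_not_rejected ht hα hΔ₀ hσ hF hw hwBV hH hL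
    (fun n => hv (s n)) (fun n => hBV (s n)) hlim
  set J : ℕ → ℝ := fun n => F (v n) + α * (TV (v n)).toReal with hJ
  have hJsub (n : ℕ) : ared α F (v n) (v (n + 1)) = J n - J (n + 1) := by
    simp only [ared, hJ]; ring
  have hJanti : Antitone J := antitone_nat_of_succ_le fun n => by
    obtain ⟨K, u, -, -, hp, ha⟩ := hacc n
    rw [hJsub] at ha
    linarith [mul_pos hσ.1 hp]
  have hJbdd : BddBelow (range J) := by
    obtain ⟨b, hb⟩ := hbdd
    refine ⟨b, ?_⟩
    rintro _ ⟨n, rfl⟩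
    have := hb (mem_range_self (v n))
    have h2 : 0 ≤ α * (TV (v n)).toReal := mul_nonneg hα.le ENNReal.toReal_nonneg
    simp only [hJ]
    linarith
  have hJlim := tendsto_atTop_ciInf hJanti hJbdd
  have hdiff : Tendsto (fun n => J n - J (n + 1)) atTop (𝓝 0) := by
    simpa using hJlim.sub (hJlim.comp (tendsto_add_atTop_nat 1))
  have hsmall := (hdiff.comp hs.tendsto_atTop).eventually_lt_const (mul_pos hσ.1 hη)
  obtain ⟨n, ⟨hnr, hmin⟩, hn⟩ := (hev.and hsmall).exists
  obtain ⟨K, u, hrej, hmn, -, ha⟩ := hacc (s n)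
  rw [hJsub] at ha
  -- Acceptance after index `k` would require a rejection at radius `k`; acceptance by index `k`
  -- decreases `J` by at least `σ η`, which is eventually impossible.
  rcases lt_or_ge k K with h | h
  · exact hnr _ (hrej k h)
  · have := mul_le_mul_of_nonneg_left (hmin K h _ hmn) hσ.1.le
    simp only [Function.comp_apply] at hn
    linarith

end SLIP

end

theorem mainTheorem7
    (t₀ tf : ℝ) (ht : t₀ < tf)
    (α : ℝ) (hα : 0 < α)
    (M : ℕ) (ν : Fin M → ℤ) (hν : StrictMono ν)
    (F : SLIP.L2 t₀ tf → ℝ)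
    (hF_lsc : LowerSemicontinuous F)
    (hF_bdd : BddBelow (range F))
    (hF_C2 : ContDiff ℝ 2 F)
    (hF_hess : ∀ ξ : SLIP.L2 t₀ tf, ∃ C : ℝ, 0 < C ∧ ∀ u w : SLIP.L2 t₀ tf,
      |fderiv ℝ (fderiv ℝ F) ξ u w| ≤ C * SLIP.l1Norm u * SLIP.l1Norm w)
    (Δ₀ : ℝ) (hΔ₀ : 0 < Δ₀)
    (σ : ℝ) (hσ : σ ∈ Ioo (0 : ℝ) 1)
    (v₀ : SLIP.L2 t₀ tf) (hv₀ : SLIP.Feasible ν v₀) (hv₀_BV : SLIP.IsBV v₀) :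
    (∀ (N : ℕ) (v : ℕ → SLIP.L2 t₀ tf),
      SLIP.IsRunWithFinalIterate α σ Δ₀ ν F v₀ N v → SLIP.LStationary ν F (v N)) ∧
    (∀ v : ℕ → SLIP.L2 t₀ tf, SLIP.IsInfiniteRun α σ Δ₀ ν F v₀ v →
      ∀ w : SLIP.L2 t₀ tf, SLIP.IsWeakStarLimitPoint v w → SLIP.LStationary ν F w) := by
  refine ⟨fun N v hrun => ?_, fun v hrun w hw => ?_⟩
  · obtain ⟨h0, hacc, hfin⟩ := hrun
    have hN : SLIP.Feasible ν (v N) ∧ SLIP.IsBV (v N) := by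
      cases N with
      | zero => rw [h0]; exact ⟨hv₀, hv₀_BV⟩
      | succ n => exact (hacc n n.lt_succ_self).feasible
    exact SLIP.LStationary_of_final ht hα hΔ₀ hσ hF_C2 hN.1 hN.2 (hF_hess _) hfin
  · obtain ⟨h0, hacc⟩ := hrun
    obtain ⟨s, hs, -, hwBV, hlim, -⟩ := hw
    have hv (n : ℕ) : SLIP.Feasible ν (v n) ∧ SLIP.IsBV (v n) := by
      cases n with
      | zero => rw [h0]; exact ⟨hv₀, hv₀_BV⟩
      | succ n => exact (hacc n).feasible
    exact SLIP.LStationary_of_infinite ht hα hΔ₀ hσ hF_C2 hF_bdd (fun n => (hv n).1)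
      (fun n => (hv n).2) hacc hs hwBV hlim (hF_hess w)
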